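/- Let $p$ be a prime and let $G=\prod_{k=1}^{s}G_k$ be a finite abelian $p$-group, where each $G_k$ is cyclic of order $p^{m_k}$ with $m_k\ge 1$. A $G$-lattice is a $G$-module whose underlying abelian group is free of finite rank; a $G$-lattice $M\neq 0$ is irreducible if it has no $G$-submodule $N$ with $0\ne N\subsetneq M$ and $M/N$ torsion free. For integers $n\ge -1$ put $$\nu(n,s)=(-1)^n\sum_{i=0}^{n}\binom{-s}{i},$$ the sum being empty (so $\nu(-1,s)=0$) for $n=-1$. For a $G$-module $M$ let $DM=\operatorname{Hom}_{\mathbb Z}(M,\mathbb Q/\mathbb Z)$ with the action $(gf)(u)=f(g^{-1}u)$, and let $\hat H^n(G,-)$, $n\in\mathbb Z$, denote Tate cohomology. Let $M$ be an irreducible $G$-lattice on which $G$ acts non-trivially. Then for every $n\in\mathbb Z$ the integer $\nu(|n|-1,s)$ is non-negative and there are isomorphisms of abelian groups $$\hat H^n(G,M)\;\simeq\;\hat H^{n-1}(G,DM)\;\simeq\;(\mathbb Z/p\mathbb Z)^{\nu(|n|-1,s)}.$$ -/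

import Mathlib

/-- The `G`-module given by an action `ρ` of `G` on an abelian group `M` is a `G`-lattice if
`M` is free of finite rank. -/
structure IsGLattice {G M : Type} [Group G] [AddCommGroup M] (ρ : Representation ℤ G M) :
    Prop where
  free : Module.Free ℤ M
  finite : Module.Finite ℤ M

/-- An irreducible `G`-lattice: a nonzero `G`-lattice `M` having no `G`-submodule `N` with
`0 ≠ N ⊊ M` and `M ⧸ N` torsion free. -/
structure IsIrreducibleGLattice {G M : Type} [Group G] [AddCommGroup M]
    (ρ : Representation ℤ G M) : Prop extends IsGLattice ρ where
  nontrivial : Nontrivial M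
  eq_bot_or_eq_top : ∀ N : AddSubgroup M, (∀ g : G, ∀ x ∈ N, ρ g x ∈ N) →
    IsAddTorsionFree (M ⧸ N) → N = ⊥ ∨ N = ⊤

/-- The dual `G`-module `DM = Hom_ℤ(M, ℚ/ℤ)`, with `G` acting by `(g f)(u) = f (g⁻¹ u)`. -/
noncomputable def dualRep {G M : Type} [Group G] [AddCommGroup M] (ρ : Representation ℤ G M) :
    Representation ℤ G (M →ₗ[ℤ] AddCircle (1 : ℚ)) :=
  Representation.linHom ρ (Representation.trivial ℤ G (AddCircle (1 : ℚ)))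

/-- `ν(n, s) = (-1)ⁿ ∑_{i=0}^{n} binom(-s, i)`, for integers `n ≥ -1`
(the sum is empty for `n = -1`). -/
noncomputable def nu (n : ℤ) (s : ℕ) : ℤ :=
  (n.negOnePow : ℤ) * ∑ i ∈ Finset.range (n + 1).toNat, Ring.choose (-(s : ℤ)) i

/-! The ring generated by `ρ(G)` in `End M` is commutative, and by a Schur argument (the kernel of a
commuting endomorphism is a submodule with torsion-free quotient) it is a domain. So `ρ(G)` is a
finite group of units of a domain, hence cyclic, generated by some `z = ρ g` of order `p ^ j` with
`j > 0`. As in `ℤ[ζ]`, `z - 1` is injective, divides `p`, and has cokernel `F` of order `p`, on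
which `G` acts trivially (`exists_sub_one`). Since `G` is abelian, `g` is an endomorphism of every
module, and it acts as the identity on Tate cohomology (`tateMap_applyAsHom`). Hence `g - 1` induces
zero, and the long exact sequence of `0 → M → M → F → 0` breaks into `0 → Ĥⁿ(M) → Ĥⁿ(F) → Ĥⁿ⁺¹(M) →
0`. All groups are therefore killed by `p`, and the orders satisfy a first-order recursion in both
directions, started by `Ĥ⁰(M) = 0` (there are no invariants). The dual is parallel: by divisibility
of `ℚ/ℤ`, `g⁻¹ - 1` is surjective on `DM`, its kernel is the dual of `F`, and `Ĥ⁻¹(DM) = 0`. After a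
shift by one degree the recursion is the same, and `ν` solves it. It remains to find the order of
`Ĥⁿ(G, F)` for `F` trivial of order `p` (`card_tateCohomology_funRep`). In place of a Künneth
formula, cyclic factors `C` are treated one at a time by comparing `A` with the functions `C → A`:
the constants play the role of restriction, the sum that of corestriction. Restriction is onto in
degrees `≥ 0`, corestriction is injective in degrees `< 0`, and their composite is `|C| = 0`; this
determines all orders. -/

open CategoryTheory

/-! ### Contracting homotopies for inhomogeneous cochains and chains -/

section

universe u

theorem Fin.contractNth_zero_cons {α : Type*} {n : ℕ} (op : α → α → α) (a : α)
    (x : Fin (n + 1) → α) :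
    Fin.contractNth 0 op (Fin.cons a x : Fin (n + 2) → α) =
      Fin.cons (op a (x 0)) (Fin.tail x) := by
  ext k
  refine Fin.cases ?_ (fun k => ?_) k
  · simp [Fin.contractNth]
  · rw [Fin.contractNth_apply_of_gt _ _ _ _ (by simp)]
    simp [Fin.tail]

theorem Fin.contractNth_succ_cons {α : Type*} {n : ℕ} (op : α → α → α) (a : α)
    (x : Fin (n + 1) → α) (j : Fin (n + 1)) :
    Fin.contractNth j.succ op (Fin.cons a x : Fin (n + 2) → α) =
      Fin.cons a (Fin.contractNth j op x) := by
  ext k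
  refine Fin.cases ?_ (fun k => ?_) k
  · simp [Fin.contractNth]
  · change _ = Fin.contractNth j op x k
    rcases lt_trichotomy (k : ℕ) j with h | h | h
    · rw [Fin.contractNth_apply_of_lt _ _ _ _ (by simpa using h),
        Fin.contractNth_apply_of_lt _ _ _ _ h]
      rfl
    · rw [Fin.contractNth_apply_of_eq _ _ _ _ (by simpa using h), Fin.cons_succ,
        Fin.contractNth_apply_of_eq _ _ _ _ h]
      rfl
    · rw [Fin.contractNth_apply_of_gt _ _ _ _ (by simpa using h), Fin.cons_succ,
        Fin.contractNth_apply_of_gt _ _ _ _ h]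

variable {k G : Type u} [CommRing k] [Group G] [Fintype G]

namespace Rep

/-- `e` exhibits the identity of `X` as the norm of a linear endomorphism. -/
def IsNormSection (X : Rep.{u} k G) (e : X.V →ₗ[k] X.V) : Prop :=
  ∀ x, ∑ g : G, X.ρ g (e (X.ρ g⁻¹ x)) = x

variable {X : Rep.{u} k G} {e : X.V →ₗ[k] X.V}

/-- Inserting `g⁻¹` in the first slot and averaging with `e` is a contracting homotopy: the cocycle
identity turns the coboundary of the averaged cochain into `∑ g e g⁻¹` applied to `f`. -/
theorem IsNormSection.exists_cochain (he : X.IsNormSection e) (n : ℕ)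
    (f : (Fin (n + 1) → G) → X) (hf : inhomogeneousCochains.d X (n + 1) f = 0) :
    ∃ h : (Fin n → G) → X, inhomogeneousCochains.d X n h = f := by
  refine ⟨fun γ => ∑ g : G, X.ρ g (e (f (Fin.cons g⁻¹ γ))), ?_⟩
  ext x
  -- The cocycle identity for `f` at `(g⁻¹, x)`, with its first two terms moved to the right.
  have key (g : G) : ∑ j : Fin (n + 1), (-1 : k) ^ ((j : ℕ) + 1) •
      f (Fin.cons g⁻¹ (Fin.contractNth j (· * ·) x)) =
      X.ρ g⁻¹ (f x) - f (Fin.cons (g⁻¹ * x 0) (Fin.tail x)) := by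
    have : _ = (0 : X) := congrFun hf (Fin.cons g⁻¹ x)
    rw [inhomogeneousCochains.d_hom_apply, Fin.sum_univ_succ] at this
    simp only [Fin.cons_zero, Fin.cons_succ, Fin.contractNth_zero_cons,
      Fin.contractNth_succ_cons, Fin.val_zero, Fin.val_succ, zero_add, pow_one,
      neg_smul, one_smul, pow_succ (-1 : k) (_ + 1), mul_neg, mul_one,
      Finset.sum_neg_distrib] at this
    rw [← add_assoc, ← sub_eq_add_neg, sub_eq_zero] at this
    exact this.symm.trans (sub_eq_add_neg _ _).symm
  have h2 : ∑ g : G, X.ρ (x 0) (X.ρ g (e (f (Fin.cons g⁻¹ (Fin.tail x))))) =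
      ∑ g : G, X.ρ g (e (f (Fin.cons (g⁻¹ * x 0) (Fin.tail x)))) := by
    refine Fintype.sum_equiv (Equiv.mulLeft (x 0)) _ _ fun g => ?_
    simp
  rw [inhomogeneousCochains.d_hom_apply]
  simp only [Finset.smul_sum]
  rw [Finset.sum_comm, map_sum, show (fun i : Fin n => x i.succ) = Fin.tail x from rfl, h2,
    ← Finset.sum_add_distrib]
  conv_rhs => rw [← he (f x)]
  refine Finset.sum_congr rfl fun g _ => ?_
  have := congrArg (fun y => X.ρ g (e y)) (key g)
  simp only [map_sum, map_smul, map_sub] at this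
  rw [this]
  abel

-- Here the homotopy `s` prepends `g` and applies `e ∘ g`; the point is `d s + s d = id`.
open Finsupp in
theorem IsNormSection.exists_chain (he : X.IsNormSection e) (n : ℕ)
    (x : (Fin (n + 1) → G) →₀ X) (hx : groupHomology.inhomogeneousChains.d X n x = 0) :
    ∃ y : (Fin (n + 2) → G) →₀ X, groupHomology.inhomogeneousChains.d X (n + 1) y = x := by
  let s (m : ℕ) : ((Fin m → G) →₀ X) →ₗ[k] ((Fin (m + 1) → G) →₀ X) :=
    lsum (R := k) k fun γ => ∑ g : G, lsingle (Fin.cons g γ) ∘ₗ e ∘ₗ X.ρ g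
  have hs (m : ℕ) (γ : Fin m → G) (a : X) :
      s m (single γ a) = ∑ g : G, single (Fin.cons g γ) (e (X.ρ g a)) := by
    simp [s]
  have key : (groupHomology.inhomogeneousChains.d X (n + 1)).hom ∘ₗ s (n + 1) +
      s n ∘ₗ (groupHomology.inhomogeneousChains.d X n).hom = LinearMap.id := by
    refine Finsupp.lhom_ext fun γ a => ?_
    have h2 : ∑ g : G, single (Fin.cons g (Fin.tail γ) : Fin (n + 1) → G)
          (e (X.ρ g (X.ρ (γ 0)⁻¹ a))) =
        ∑ g : G, single (Fin.cons (g * γ 0) (Fin.tail γ)) (e (X.ρ g a)) := by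
      refine (Fintype.sum_equiv (Equiv.mulRight (γ 0)) _ _ fun g => ?_).symm
      simp
    have h3 : ∑ g : G, X.ρ g⁻¹ (e (X.ρ g a)) = a := by
      conv_rhs => rw [← he a]
      exact Fintype.sum_equiv (Equiv.inv G) _ _ fun g => by simp
    have h3' : ∑ g : G, single γ (X.ρ g⁻¹ (e (X.ρ g a))) = single γ a := by
      conv_rhs => rw [← h3]
      exact (map_sum (singleAddHom γ) _ _).symm
    have hd (m : ℕ) (γ : Fin (m + 1) → G) (a : X) :
        (groupHomology.inhomogeneousChains.d X m).hom (single γ a) = _ :=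
      groupHomology.inhomogeneousChains.d_single m γ a
    simp only [LinearMap.add_apply, LinearMap.comp_apply, hs, LinearMap.id_apply]
    simp only [map_sum, map_add, map_smul, hs, hd,
      Fin.sum_univ_succ (n := n + 1), Fin.cons_zero, Fin.cons_succ, Fin.contractNth_zero_cons,
      Fin.contractNth_succ_cons, Fin.val_zero, Fin.val_succ, zero_add, pow_one,
      neg_smul, one_smul, pow_succ (-1 : k) (_ + 1), mul_neg, mul_one,
      Finset.sum_neg_distrib, Finset.sum_add_distrib]
    rw [h3', show (fun i : Fin n => γ i.succ) = Fin.tail γ from rfl, h2, Finset.sum_comm]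
    simp only [Finset.smul_sum]
    abel
  refine ⟨s (n + 1) x, ?_⟩
  have := LinearMap.congr_fun key x
  simpa [hx] using this

end Rep

end

/-! ### Homology classes by elements; vanishing of Tate cohomology -/

section

universe u

variable {k : Type u} [CommRing k]

namespace CochainComplex

variable {K L : CochainComplex (ModuleCat.{u} k) ℤ}

theorem homologyπ_eq_zero_iff (i j : ℤ) (hij : i + 1 = j) (z : K.cycles j) :
    K.homologyπ j z = 0 ↔ ∃ y : K.X i, K.d i j y = K.iCycles j z := by
  have hp : (ComplexShape.up ℤ).prev j = i := by rw [CochainComplex.prev]; omega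
  have ex : (ShortComplex.mk (K.toCycles i j) (K.homologyπ j)
      (K.toCycles_comp_homologyπ i j)).Exact :=
    ShortComplex.exact_of_g_is_cokernel _ (K.homologyIsCokernel i j hp)
  rw [ShortComplex.moduleCat_exact_iff] at ex
  have hd (y : K.X i) : K.iCycles j (K.toCycles i j y) = K.d i j y := by
    rw [← K.toCycles_i i j]; rfl
  constructor
  · intro h
    obtain ⟨y, hy⟩ := ex z h
    exact ⟨y, by rw [← hd]; exact congrArg _ hy⟩
  · rintro ⟨y, hy⟩
    have : K.toCycles i j y = z :=
      (ModuleCat.mono_iff_injective (K.iCycles j)).1 inferInstance (by rw [hd, hy])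
    rw [← this]
    exact congrArg (fun f => f.hom y) (K.toCycles_comp_homologyπ i j)

theorem exists_homologyπ_eq (j : ℤ) (h : K.homology j) : ∃ z, K.homologyπ j z = h :=
  (ModuleCat.epi_iff_surjective (K.homologyπ j)).1 inferInstance h

theorem d_iCycles (j l : ℤ) (z : K.cycles j) : K.d j l (K.iCycles j z) = 0 :=
  congrArg (fun f => f.hom z) (K.iCycles_d j l)

theorem exists_iCycles_eq (j l : ℤ) (hjl : j + 1 = l) (x : K.X j) (hx : K.d j l x = 0) :
    ∃ z, K.iCycles j z = x :=
  ⟨K.cyclesMk x l (by rw [CochainComplex.next]; omega) hx, K.i_cyclesMk x l _ hx⟩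

theorem homologyMap_homologyπ (f : K ⟶ L) (j : ℤ) (z : K.cycles j) :
    HomologicalComplex.homologyMap f j (K.homologyπ j z) =
      L.homologyπ j (HomologicalComplex.cyclesMap f j z) :=
  congrArg (fun f => f.hom z) (HomologicalComplex.homologyπ_naturality f j)

theorem iCycles_cyclesMap (f : K ⟶ L) (j : ℤ) (z : K.cycles j) :
    L.iCycles j (HomologicalComplex.cyclesMap f j z) = f.f j (K.iCycles j z) :=
  congrArg (fun f => f.hom z) (HomologicalComplex.cyclesMap_i f j)

theorem iCycles_injective (j : ℤ) : Function.Injective (K.iCycles j) :=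
  (ModuleCat.mono_iff_injective (K.iCycles j)).1 inferInstance

theorem subsingleton_homology (i j l : ℤ) (hij : i + 1 = j)
    (h : ∀ x : K.X j, K.d j l x = 0 → ∃ y, K.d i j y = x) : Subsingleton (K.homology j) := by
  refine ⟨fun a b => ?_⟩
  have (a : K.homology j) : a = 0 := by
    obtain ⟨z, rfl⟩ := exists_homologyπ_eq j a
    exact (homologyπ_eq_zero_iff i j hij z).2 (h _ (d_iCycles j l z))
  rw [this a, this b]

theorem homologyMap_eq_zero (f : K ⟶ L) (j l : ℤ)
    (h : ∀ x : K.X j, K.d j l x = 0 → f.f j x = 0) (a : K.homology j) :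
    HomologicalComplex.homologyMap f j a = 0 := by
  obtain ⟨z, rfl⟩ := exists_homologyπ_eq j a
  have : HomologicalComplex.cyclesMap f j z = 0 := by
    apply iCycles_injective
    rw [iCycles_cyclesMap, h _ (d_iCycles j l z), map_zero]
  rw [homologyMap_homologyπ, this, map_zero]

theorem homologyMap_surjective (f : K ⟶ L) (j l : ℤ) (hjl : j + 1 = l)
    (h : ∀ y : L.X j, L.d j l y = 0 → ∃ x, K.d j l x = 0 ∧ f.f j x = y) :
    Function.Surjective (HomologicalComplex.homologyMap f j) := by
  intro b
  obtain ⟨w, rfl⟩ := exists_homologyπ_eq j b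
  obtain ⟨x, hx, hxw⟩ := h _ (d_iCycles j l w)
  obtain ⟨z, rfl⟩ := exists_iCycles_eq j l hjl x hx
  refine ⟨K.homologyπ j z, ?_⟩
  rw [homologyMap_homologyπ]
  congr 1
  apply iCycles_injective
  rw [iCycles_cyclesMap, hxw]

theorem homologyMap_injective (f : K ⟶ L) (i j : ℤ) (hij : i + 1 = j)
    (h : ∀ (x : K.X j) (y : L.X i), L.d i j y = f.f j x → ∃ x', K.d i j x' = x) :
    Function.Injective (HomologicalComplex.homologyMap f j) := by
  rw [injective_iff_map_eq_zero]
  intro a ha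
  obtain ⟨z, rfl⟩ := exists_homologyπ_eq j a
  rw [homologyMap_homologyπ, homologyπ_eq_zero_iff i j hij, iCycles_cyclesMap] at ha
  obtain ⟨y, hy⟩ := ha
  exact (homologyπ_eq_zero_iff i j hij z).2 (h _ y hy)

theorem card_homology_of_d_to_eq_zero (i j l : ℤ) (hij : i + 1 = j) (hjl : j + 1 = l)
    (h : ∀ y, K.d i j y = 0) :
    Nat.card (K.homology j) = Nat.card {x : K.X j // K.d j l x = 0} := by
  have h1 : Function.Bijective (K.homologyπ j) := by
    refine ⟨?_, exists_homologyπ_eq j⟩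
    rw [injective_iff_map_eq_zero]
    intro z hz
    obtain ⟨y, hy⟩ := (homologyπ_eq_zero_iff i j hij z).1 hz
    apply iCycles_injective
    rw [← hy, h, map_zero]
  have h2 : Function.Bijective
      (fun z : K.cycles j => (⟨K.iCycles j z, d_iCycles j l z⟩ : {x : K.X j // K.d j l x = 0})) := by
    refine ⟨fun a b hab => iCycles_injective j (congrArg Subtype.val hab), fun x => ?_⟩
    obtain ⟨z, hz⟩ := exists_iCycles_eq j l hjl x.1 x.2
    exact ⟨z, Subtype.ext hz⟩
  rw [← Nat.card_congr (Equiv.ofBijective _ h1), Nat.card_congr (Equiv.ofBijective _ h2)]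

theorem card_homology_of_d_from_eq_zero (i j l : ℤ) (hij : i + 1 = j) (hjl : j + 1 = l)
    (h : ∀ y, K.d j l y = 0) {F : Type*} [AddCommGroup F] (φ : K.X j →+ F)
    (hφ : Function.Surjective φ) (hφd : ∀ x, φ x = 0 ↔ ∃ y, K.d i j y = x) :
    Nat.card (K.homology j) = Nat.card F := by
  let ψ : K.cycles j →+ F := φ.comp (K.iCycles j).hom.toAddMonoidHom
  have hψ (z) : ψ z = φ (K.iCycles j z) := rfl
  have hs : Function.Surjective ψ := fun x => by
    obtain ⟨y, rfl⟩ := hφ x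
    obtain ⟨z, rfl⟩ := exists_iCycles_eq j l hjl y (h y)
    exact ⟨z, rfl⟩
  let π : K.cycles j →+ K.homology j := (K.homologyπ j).hom.toAddMonoidHom
  have hk : π.ker = ψ.ker := by
    ext z
    rw [AddMonoidHom.mem_ker, AddMonoidHom.mem_ker, hψ, hφd]
    exact homologyπ_eq_zero_iff i j hij z
  rw [← Nat.card_congr (QuotientAddGroup.quotientKerEquivOfSurjective ψ hs).toEquiv, ← hk,
    Nat.card_congr (QuotientAddGroup.quotientKerEquivOfSurjective π
      (exists_homologyπ_eq j)).toEquiv]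

end CochainComplex

variable {G : Type u} [Group G] [Fintype G]

namespace Rep

variable {X : Rep.{u} k G} {e : X.V →ₗ[k] X.V}

theorem tateComplex_d_zero_apply_eq_zero_iff (f : (Fin 0 → G) → X) :
    (tateComplex X).d 0 1 f = 0 ↔ ∀ g, X.ρ g (f default) = f default := by
  change (groupCohomology.inhomogeneousCochains X).d 0 1 f = 0 ↔ _
  rw [groupCohomology.inhomogeneousCochains.d_def]
  have h (x : Fin 1 → G) : inhomogeneousCochains.d X 0 f x =
      X.ρ (x 0) (f default) - f default := by
    rw [inhomogeneousCochains.d_hom_apply]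
    simp [Subsingleton.elim _ (default : Fin 0 → G), sub_eq_add_neg]
  constructor
  · intro hf g
    have := congrFun hf (fun _ => g)
    rw [h] at this
    exact sub_eq_zero.1 this
  · intro hf
    ext x
    rw [h, hf, sub_self]
    rfl

theorem tateComplex_d_neg_one_apply (x : (Fin 0 → G) →₀ X) (γ : Fin 0 → G) :
    ((tateComplex X).d (-1) 0 x : (Fin 0 → G) → X) γ = X.ρ.norm (x default) := by
  change X.tateNorm x γ = _
  rw [Rep.tateNorm_eq]
  change (Finsupp.lsum k (fun _ ↦ LinearMap.pi fun _ ↦ X.ρ.norm) x : (Fin 0 → G) → X) γ = _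
  rw [Finsupp.lsum_apply, Finsupp.sum_fintype _ _ (by simp)]
  simp [Subsingleton.elim _ (default : Fin 0 → G)]

theorem tateComplex_d_neg_two_apply_single (g : G) (a : X) :
    (tateComplex X).d (-2) (-1) (Finsupp.single (fun _ => g) a : (Fin 1 → G) →₀ X) =
      (Finsupp.single default (X.ρ g⁻¹ a - a) : (Fin 0 → G) →₀ X) := by
  change (groupHomology.inhomogeneousChains X).d 1 0 _ = _
  rw [groupHomology.inhomogeneousChains.d_def]
  refine (groupHomology.inhomogeneousChains.d_single 0 _ _).trans ?_
  simp [Subsingleton.elim _ (default : Fin 0 → G), sub_eq_add_neg, Finsupp.single_add]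

/-- The homotopies settle degrees `≥ 1` and `≤ -2`. Degrees `0` and `-1`, where the norm glues
cochains to chains, are done by hand. -/
theorem IsNormSection.subsingleton_tateCohomology (he : X.IsNormSection e) (n : ℤ) :
    Subsingleton (tateCohomology X n) := by
  rcases n with (_ | n) | (_ | n)
  · refine CochainComplex.subsingleton_homology (K := tateComplex X) (-1) 0 1 rfl fun x hx => ?_
    change (Fin 0 → G) → X at x
    rw [tateComplex_d_zero_apply_eq_zero_iff] at hx
    -- For an invariant `x` the section identity says that `x` is the norm of `e x`.
    refine ⟨(Finsupp.single default (e (x default)) : (Fin 0 → G) →₀ X), ?_⟩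
    refine funext (α := Fin 0 → G) (β := fun _ => X) fun γ => ?_
    refine (tateComplex_d_neg_one_apply _ _).trans ?_
    rw [Finsupp.single_eq_same, Subsingleton.elim γ default]
    conv_rhs => rw [← he (x default)]
    simp [Representation.norm, hx]
  · refine CochainComplex.subsingleton_homology (K := tateComplex X) n (n + 1 : ℕ) (n + 2 : ℕ)
      rfl fun x hx => ?_
    obtain ⟨h, hh⟩ := he.exists_cochain n x <| by
      rw [← groupCohomology.inhomogeneousCochains.d_def]
      exact hx
    refine ⟨h, ?_⟩
    rw [← groupCohomology.inhomogeneousCochains.d_def] at hh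
    exact hh
  · refine CochainComplex.subsingleton_homology (K := tateComplex X) (-2) (-1) 0 rfl fun x hx => ?_
    change (Fin 0 → G) →₀ X at x
    have hx' : X.ρ.norm (x default) = 0 := by
      rw [← tateComplex_d_neg_one_apply x default, hx]
      rfl
    -- The boundary of this chain is `∑ g⁻¹ e g x - e (∑ g x)`, whose second term vanishes because
    -- `x` has norm zero.
    refine ⟨(∑ g : G, Finsupp.single (fun _ => g) (e (X.ρ g (x default))) :
      (Fin 1 → G) →₀ X), ?_⟩
    refine (map_sum ((tateComplex X).d (-2) (-1)).hom _ _).trans ?_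
    refine (Finset.sum_congr rfl fun g _ => tateComplex_d_neg_two_apply_single g _).trans ?_
    change (∑ g : G, Finsupp.single default (X.ρ g⁻¹ (e (X.ρ g (x default))) -
      e (X.ρ g (x default))) : (Fin 0 → G) →₀ X) = x
    rw [← Finsupp.single_finsetSum, Finset.sum_sub_distrib]
    have h1 : ∑ g : G, e (X.ρ g (x default)) = 0 := by
      rw [← map_sum, ← map_zero e, ← hx']
      simp [Representation.norm]
    have h2 : ∑ g : G, X.ρ g⁻¹ (e (X.ρ g (x default))) = x default := by
      conv_rhs => rw [← he (x default)]
      exact Fintype.sum_equiv (Equiv.inv G) _ _ fun g => by simp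
    rw [h1, h2, sub_zero]
    exact (Finsupp.unique_single x).symm
  · refine CochainComplex.subsingleton_homology (K := tateComplex X) (Int.negSucc (n + 2))
      (Int.negSucc (n + 1)) (Int.negSucc n) rfl fun x hx => ?_
    obtain ⟨h, hh⟩ := he.exists_chain n x <| by
      rw [← groupHomology.inhomogeneousChains.d_def]
      exact hx
    refine ⟨h, ?_⟩
    rw [← groupHomology.inhomogeneousChains.d_def] at hh
    exact hh

end Rep

end

/-! ### Functoriality and long exact sequences of Tate cohomology -/

section

universe u

variable {k : Type u} [CommRing k] {G : Type u} [Group G]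

namespace Rep

/-- The morphism of representations given by an equivariant linear map. -/
def mkHom {X Y : Rep.{u} k G} (f : X.V →ₗ[k] Y.V) (h : ∀ g x, f (X.ρ g x) = Y.ρ g (f x)) :
    X ⟶ Y :=
  Rep.ofHom ⟨f, fun g => LinearMap.ext (h g)⟩

/-- `0 ⟶ X ⟶ Y ⟶ Z ⟶ 0` is exact. -/
structure IsShortExact {X Y Z : Rep.{u} k G} (f : X ⟶ Y) (g : Y ⟶ Z) : Prop where
  injective : Function.Injective f.hom
  exact : ∀ y, g.hom y = 0 ↔ ∃ x, f.hom x = y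
  surjective : Function.Surjective g.hom

namespace IsShortExact

variable {X Y Z : Rep.{u} k G} {f : X ⟶ Y} {g : Y ⟶ Z}

theorem comp_eq_zero (h : IsShortExact f g) : f ≫ g = 0 := by
  ext x
  exact (h.exact _).2 ⟨x, rfl⟩

theorem shortExact (h : IsShortExact f g) : (ShortComplex.mk f g h.comp_eq_zero).ShortExact where
  exact := by
    rw [← ShortComplex.exact_map_iff_of_faithful _ (forget₂ (Rep k G) (ModuleCat k)),
      ShortComplex.ShortExact.moduleCat_exact_iff_function_exact]
    exact h.exact
  mono_f := (Rep.mono_iff_injective f).2 h.injective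
  epi_g := (Rep.epi_iff_surjective g).2 h.surjective

end IsShortExact

variable [Fintype G]

/-- The map induced on Tate cohomology by a morphism of representations. -/
noncomputable def tateMap {X Y : Rep.{u} k G} (f : X ⟶ Y) (n : ℤ) :
    tateCohomology X n →+ tateCohomology Y n :=
  ((tateCohomologyFunctor n).map f).hom.toAddMonoidHom

section

variable {X Y Z : Rep.{u} k G}

theorem tateMap_apply (f : X ⟶ Y) (n : ℤ) (a : tateCohomology X n) :
    tateMap f n a = HomologicalComplex.homologyMap (tateComplex.map f) n a := rfl

theorem tateMap_comp (f : X ⟶ Y) (g : Y ⟶ Z) (n : ℤ) (a : tateCohomology X n) :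
    tateMap (f ≫ g) n a = tateMap g n (tateMap f n a) := by
  simp [tateMap]

theorem tateMap_id (n : ℤ) (a : tateCohomology X n) : tateMap (𝟙 X) n a = a := by
  simp [tateMap]

instance (n : ℤ) : (tateCohomologyFunctor (R := k) (G := G) n).Additive := by
  unfold tateCohomologyFunctor
  infer_instance

theorem tateMap_sub (f g : X ⟶ Y) (n : ℤ) (a : tateCohomology X n) :
    tateMap (f - g) n a = tateMap f n a - tateMap g n a := by
  simp [tateMap, Functor.map_sub]

theorem tateMap_nsmul (f : X ⟶ Y) (m : ℕ) (n : ℤ) (a : tateCohomology X n) :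
    tateMap (m • f) n a = m • tateMap f n a := by
  simp [tateMap]

theorem tateMap_zero (n : ℤ) (a : tateCohomology X n) : tateMap (0 : X ⟶ Y) n a = 0 := by
  simp [tateMap]

theorem tateComplex_map_f_zero (f : X ⟶ Y) (x : (Fin 0 → G) → X) :
    ((tateComplex.map f).f 0 x : (Fin 0 → G) → Y) = fun γ => f.hom (x γ) := rfl

theorem tateComplex_map_f_neg_one (f : X ⟶ Y) (x : (Fin 0 → G) →₀ X) :
    ((tateComplex.map f).f (-1) x : (Fin 0 → G) →₀ Y) =
      Finsupp.single default (f.hom (x default)) := by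
  change ((groupHomology.chainsMap (MonoidHom.id G) f).f 0).hom x = _
  rw [groupHomology.chainsMap_id_f_hom_eq_mapRange]
  refine (Finsupp.unique_single _).trans ?_
  rfl

/-- A bijective morphism of representations induces isomorphisms on Tate cohomology. -/
noncomputable def tateEquiv (f : X ⟶ Y) (hf : Function.Bijective f.hom) (n : ℤ) :
    tateCohomology X n ≃+ tateCohomology Y n :=
  AddEquiv.ofBijective (tateMap f n) <| by
    have := (Rep.mono_iff_injective f).2 hf.1
    have := (Rep.epi_iff_surjective f).2 hf.2
    have := isIso_of_mono_of_epi f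
    exact (ConcreteCategory.isIso_iff_bijective ((tateCohomologyFunctor n).map f)).1 inferInstance

end

namespace IsShortExact

variable {X Y Z : Rep.{u} k G} {f : X ⟶ Y} {g : Y ⟶ Z}

/-- The connecting homomorphism. -/
noncomputable def δ (h : IsShortExact f g) (n m : ℤ) (hnm : n + 1 = m) :
    tateCohomology Z n →+ tateCohomology X m :=
  ((TateCohomology.map_tateComplexFunctor_shortExact h.shortExact).δ n m
    hnm).hom.toAddMonoidHom

theorem exact₁ (h : IsShortExact f g) (n m : ℤ) (hnm : n + 1 = m) :
    Function.Exact (h.δ n m hnm) (tateMap f m) :=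
  (ShortComplex.ShortExact.moduleCat_exact_iff_function_exact _).1
    ((TateCohomology.map_tateComplexFunctor_shortExact h.shortExact).homology_exact₁ n m hnm)

theorem exact₂ (h : IsShortExact f g) (n : ℤ) :
    Function.Exact (tateMap f n) (tateMap g n) :=
  (ShortComplex.ShortExact.moduleCat_exact_iff_function_exact _).1
    ((TateCohomology.map_tateComplexFunctor_shortExact h.shortExact).homology_exact₂ n)

theorem exact₃ (h : IsShortExact f g) (n m : ℤ) (hnm : n + 1 = m) :
    Function.Exact (tateMap g n) (h.δ n m hnm) :=
  (ShortComplex.ShortExact.moduleCat_exact_iff_function_exact _).1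
    ((TateCohomology.map_tateComplexFunctor_shortExact h.shortExact).homology_exact₃ n m hnm)

theorem δ_surjective (h : IsShortExact f g) (n m : ℤ) (hnm : n + 1 = m)
    [Subsingleton (tateCohomology Y m)] : Function.Surjective (h.δ n m hnm) :=
  fun x => (h.exact₁ n m hnm x).1 (Subsingleton.elim _ _)

theorem δ_injective (h : IsShortExact f g) (n m : ℤ) (hnm : n + 1 = m)
    [Subsingleton (tateCohomology Y n)] : Function.Injective (h.δ n m hnm) := by
  rw [injective_iff_map_eq_zero]
  intro x hx
  obtain ⟨y, rfl⟩ := (h.exact₃ n m hnm x).1 hx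
  rw [Subsingleton.elim y 0, map_zero]

theorem δ_naturality (h : IsShortExact f g) {X' Y' Z' : Rep.{u} k G} {f' : X' ⟶ Y'} {g' : Y' ⟶ Z'}
    (h' : IsShortExact f' g') (a : X ⟶ X') (b : Y ⟶ Y') (c : Z ⟶ Z')
    (hab : ∀ x, f'.hom (a.hom x) = b.hom (f.hom x)) (hbc : ∀ y, g'.hom (b.hom y) = c.hom (g.hom y))
    (n m : ℤ) (hnm : n + 1 = m) (x : tateCohomology Z n) :
    tateMap a m (h.δ n m hnm x) = h'.δ n m hnm (tateMap c n x) := by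
  let F : ShortComplex.mk f g h.comp_eq_zero ⟶ ShortComplex.mk f' g' h'.comp_eq_zero :=
    { τ₁ := a, τ₂ := b, τ₃ := c, comm₁₂ := by ext x; exact hab x, comm₂₃ := by ext x; exact hbc x }
  exact congrArg (fun f => f.hom x) (HomologicalComplex.HomologySequence.δ_naturality
    ((tateComplexFunctor k G).mapShortComplex.map F)
    (TateCohomology.map_tateComplexFunctor_shortExact h.shortExact)
    (TateCohomology.map_tateComplexFunctor_shortExact h'.shortExact) n m hnm)

end IsShortExact

open Representation in
theorem exists_tateComplex_d_neg_two_eq_iff (X : Rep.{u} k G) (x : (Fin 0 → G) →₀ X) :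
    (∃ y, (tateComplex X).d (-2) (-1) y = x) ↔ x default ∈ Coinvariants.ker X.ρ := by
  constructor
  · rintro ⟨y, rfl⟩
    change (Fin 1 → G) →₀ X at y
    induction y using Finsupp.induction_linear with
    | zero =>
      rw [show (tateComplex X).d (-2) (-1) (0 : (Fin 1 → G) →₀ X) = 0 from map_zero _]
      exact zero_mem _
    | add a b ha hb =>
      rw [show (tateComplex X).d (-2) (-1) (a + b) = _ from map_add _ _ _]
      exact add_mem ha hb
    | single γ a =>
      rw [show γ = fun _ => γ 0 from funext fun i => congrArg γ (Subsingleton.elim _ _),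
        tateComplex_d_neg_two_apply_single, Finsupp.single_eq_same]
      exact Coinvariants.sub_mem_ker _ _
  · intro hx
    let φ : X.V →ₗ[k] ((tateComplex X).X (-1)) :=
      Finsupp.lsingle (M := X.V) (default : Fin 0 → G)
    have hle : Coinvariants.ker X.ρ ≤
        (LinearMap.range ((tateComplex X).d (-2) (-1)).hom).comap φ := by
      refine Submodule.span_le.2 ?_
      rintro _ ⟨⟨g, a⟩, rfl⟩
      refine ⟨(Finsupp.single (fun _ => g⁻¹) a : (Fin 1 → G) →₀ X), ?_⟩
      refine (tateComplex_d_neg_two_apply_single _ _).trans ?_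
      rw [inv_inv]
      rfl
    obtain ⟨y, hy⟩ := hle hx
    exact ⟨y, hy.trans (Finsupp.unique_single x).symm⟩

end Rep

end

/-! ### Modules of functions on a group, and dimension shifting -/

section

universe u

variable {k : Type u} [CommRing k] {G : Type u} [Group G]

namespace Rep

/-- The kernel of a morphism of representations. -/
abbrev kerRep {X Y : Rep.{u} k G} (f : X ⟶ Y) : Rep.{u} k G :=
  Rep.subrepresentation X (LinearMap.ker f.hom.toLinearMap) fun g x hx => by
    change f.hom (X.ρ g x) = 0
    rw [Rep.hom_comm_apply, show f.hom x = 0 from hx, map_zero]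

/-- The cokernel of a morphism of representations. -/
abbrev cokerRep {X Y : Rep.{u} k G} (f : X ⟶ Y) : Rep.{u} k G :=
  Rep.quotient Y (LinearMap.range f.hom.toLinearMap) <| by
    rintro g _ ⟨x, rfl⟩
    exact ⟨X.ρ g x, Rep.hom_comm_apply f g x⟩

/-- The inclusion of the kernel. -/
abbrev kerι {X Y : Rep.{u} k G} (f : X ⟶ Y) : kerRep f ⟶ X :=
  Rep.subtype X _ _

/-- The projection to the cokernel. -/
abbrev cokerπ {X Y : Rep.{u} k G} (f : X ⟶ Y) : Y ⟶ cokerRep f :=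
  Rep.mkQ Y _ _

theorem isShortExact_kerι {X Y : Rep.{u} k G} (f : X ⟶ Y) (hf : Function.Surjective f.hom) :
    IsShortExact (kerι f) f where
  injective := Subtype.val_injective
  exact y := ⟨fun h => ⟨⟨y, h⟩, rfl⟩, by rintro ⟨x, rfl⟩; exact x.2⟩
  surjective := hf

theorem isShortExact_cokerπ {X Y : Rep.{u} k G} (f : X ⟶ Y) (hf : Function.Injective f.hom) :
    IsShortExact f (cokerπ f) where
  injective := hf
  exact _ := Submodule.Quotient.mk_eq_zero _
  surjective := Submodule.mkQ_surjective _

variable {P : Type u} [Group P]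

/-- The action of `G` on the `A`-valued functions on a group `P`, through `π : G →* P` on the source
and on the values. -/
def funAction (π : G →* P) (A : Rep.{u} k G) : Representation k G (P → A.V) where
  toFun g := (A.ρ g).compLeft P ∘ₗ LinearMap.funLeft k A.V (π g⁻¹ * ·)
  map_one' := by ext; simp
  map_mul' g h := by ext; simp [LinearMap.funLeft, mul_assoc]

/-- The `A`-valued functions on a group `P`, with `G` acting through `π : G →* P` on the source and
on the values. -/
abbrev funRep (π : G →* P) (A : Rep.{u} k G) : Rep.{u} k G :=
  Rep.of (funAction π A)

variable (π : G →* P) (A : Rep.{u} k G)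

theorem funRep_ρ_apply (g : G) (f : P → A.V) (x : P) :
    ((funRep π A).ρ g f : P → A.V) x = A.ρ g (f (π g⁻¹ * x)) := rfl

theorem funRep_ρ_single [DecidableEq P] (g : G) (x : P) (a : A.V) :
    ((funRep π A).ρ g (Pi.single x a) : P → A.V) = Pi.single (π g * x) (A.ρ g a) := by
  ext y
  rw [funRep_ρ_apply]
  by_cases h : y = π g * x
  · subst h
    simp
  · rw [Pi.single_eq_of_ne h, Pi.single_eq_of_ne, map_zero]
    rintro rfl
    simp at h

/-- The inclusion of the constant functions. -/
def funConst : A ⟶ funRep π A :=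
  mkHom (LinearMap.pi fun _ => LinearMap.id) fun _ _ => rfl

/-- The sum of the values of a function. -/
def funSum [Fintype P] : funRep π A ⟶ A :=
  mkHom (∑ x : P, LinearMap.proj x : (P → A.V) →ₗ[k] A.V) fun g f => by
    rw [LinearMap.sum_apply, LinearMap.sum_apply, map_sum]
    exact Fintype.sum_equiv (Equiv.mulLeft (π g⁻¹)) _ _ fun x => rfl

/-- Postcomposition with a morphism. -/
def funMap {A B : Rep.{u} k G} (φ : A ⟶ B) : funRep π A ⟶ funRep π B :=
  mkHom (φ.hom.toLinearMap.compLeft P) fun g _ => funext fun _ => Rep.hom_comm_apply φ g _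

@[simp]
theorem funSum_hom_apply [Fintype P] (f : P → A.V) : (funSum π A).hom f = ∑ x, f x :=
  LinearMap.sum_apply _ _ _

theorem funSum_funMap [Fintype P] {A B : Rep.{u} k G} (φ : A ⟶ B) (f : P → A.V) :
    (funSum π B).hom ((funMap π φ).hom f) = φ.hom ((funSum π A).hom f) := by
  rw [funSum_hom_apply, funSum_hom_apply, map_sum]
  rfl

theorem funSum_funConst [Fintype P] (a : A) :
    (funSum π A).hom ((funConst π A).hom a) = Fintype.card P • a := by
  rw [funSum_hom_apply]
  exact Finset.sum_const a

theorem funConst_injective : Function.Injective (funConst π A).hom := fun _ _ h =>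
  congrFun h (1 : P)

theorem funSum_single [Fintype P] [DecidableEq P] (x : P) (a : A.V) :
    (funSum π A).hom (Pi.single x a : P → A.V) = a := by
  rw [funSum_hom_apply, Finset.sum_pi_single']
  simp

theorem funSum_surjective [Fintype P] : Function.Surjective (funSum π A).hom := fun a => by
  classical
  exact ⟨_, funSum_single π A 1 a⟩

theorem IsShortExact.funMap {A B C : Rep.{u} k G} {φ : A ⟶ B} {ψ : B ⟶ C}
    (h : IsShortExact φ ψ) : IsShortExact (funMap π φ) (funMap π ψ) where
  injective f f' hf := funext fun x => h.injective (congrFun hf x)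
  exact f := by
    constructor
    · intro hf
      choose f' hf' using fun x => (h.exact (f x)).1 (congrFun hf x)
      exact ⟨f', funext hf'⟩
    · rintro ⟨f', rfl⟩
      exact funext fun x => (h.exact _).2 ⟨f' x, rfl⟩
  surjective f := by
    choose f' hf' using fun x => h.surjective (f x)
    exact ⟨f', funext hf'⟩

/-- Currying. -/
def funCurry {Q : Type u} [Group Q] (χ : G →* Q) :
    funRep (π.prod χ) A ⟶ funRep χ (funRep π A) :=
  mkHom (X := funRep (π.prod χ) A) (Y := funRep χ (funRep π A))
    { toFun := fun (f : P × Q → A.V) (y : Q) (x : P) => f (x, y)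
      map_add' := fun _ _ => rfl
      map_smul' := fun _ _ => rfl } fun _ _ => rfl

theorem funCurry_bijective {Q : Type u} [Group Q] (χ : G →* Q) :
    Function.Bijective (funCurry π A χ).hom := by
  constructor
  · intro f f' h
    exact funext fun xy => congrFun (congrFun h xy.2) xy.1
  · intro f
    exact ⟨fun xy => f xy.2 xy.1, rfl⟩

variable [Fintype G]

/-- Cutting a function down to its value at `1` is a norm section: its conjugate by `g` cuts down to
the value at `π g`, and these add up to the identity. -/
theorem subsingleton_tateCohomology_funRep (hπ : Function.Bijective π) (n : ℤ) :
    Subsingleton (tateCohomology (funRep π A) n) := by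
  classical
  let e : (P → A.V) →ₗ[k] (P → A.V) := LinearMap.single k (fun _ => A.V) 1 ∘ₗ LinearMap.proj 1
  refine IsNormSection.subsingleton_tateCohomology (e := e) (fun f => ?_) n
  change P → A.V at f
  have h (g : G) : ((funRep π A).ρ g (e ((funRep π A).ρ g⁻¹ f)) : P → A.V) =
      Pi.single (π g) (f (π g)) := by
    refine (funRep_ρ_single π A g 1 _).trans ?_
    rw [LinearMap.proj_apply, funRep_ρ_apply, mul_one]
    simp
  have : Fintype P := Fintype.ofBijective π hπ
  refine (Finset.sum_congr rfl fun g _ => h g).trans ?_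
  refine (Fintype.sum_bijective π hπ _ (fun x => (Pi.single x (f x) : P → A.V))
    fun g => rfl).trans ?_
  exact Finset.univ_sum_single f

theorem subsingleton_tateCohomology_funRep_funRep {Q : Type u} [Group Q] (χ : G →* Q)
    (h : Function.Bijective (π.prod χ)) (n : ℤ) :
    Subsingleton (tateCohomology (funRep χ (funRep π A)) n) :=
  have := subsingleton_tateCohomology_funRep (π.prod χ) A h n
  (tateEquiv _ (funCurry_bijective π A χ) n).symm.injective.subsingleton

end Rep

namespace Rep

variable {G : Type u} [CommGroup G] [Fintype G]

/-- In degree `0` classes are represented by invariants, which `g` fixes. Other degrees follow by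
dimension shifting, since the connecting maps commute with `g`: upwards by the constants in the
acyclic functions `G → X`, downwards by the sum map. -/
theorem tateMap_applyAsHom (X : Rep.{u} k G) (g : G) (n : ℤ) (a : tateCohomology X n) :
    tateMap (X.applyAsHom g) n a = a := by
  have hid : Function.Bijective (MonoidHom.id G) := Function.bijective_id
  induction n using Int.induction_on generalizing X with
  | zero =>
    rw [← sub_eq_zero]
    conv_lhs => rw [← tateMap_id 0 a, ← tateMap_comp, ← tateMap_sub, tateMap_apply]
    refine CochainComplex.homologyMap_eq_zero (K := tateComplex X) _ 0 1 (fun x hx => ?_) a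
    change (Fin 0 → G) → X at x
    rw [tateComplex_d_zero_apply_eq_zero_iff] at hx
    refine (tateComplex_map_f_zero _ x).trans (funext fun γ => ?_)
    rw [Subsingleton.elim γ default]
    change X.ρ g (x default) - x default = 0
    rw [hx, sub_self]
  | succ n ih =>
    have h := isShortExact_cokerπ _ (funConst_injective (MonoidHom.id G) X)
    have := subsingleton_tateCohomology_funRep (MonoidHom.id G) X hid (n + 1)
    obtain ⟨b, rfl⟩ := h.δ_surjective n (n + 1) rfl a
    rw [h.δ_naturality h (X.applyAsHom g) ((funRep (MonoidHom.id G) X).applyAsHom g)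
      ((cokerRep _).applyAsHom g) (fun x => rfl) (fun x => rfl), ih]
  | pred n ih =>
    have h := isShortExact_kerι _ (funSum_surjective (MonoidHom.id G) X)
    have := subsingleton_tateCohomology_funRep (MonoidHom.id G) X hid (-n - 1)
    apply h.δ_injective (-n - 1) (-n) (by ring)
    rw [← h.δ_naturality h ((kerRep _).applyAsHom g) ((funRep (MonoidHom.id G) X).applyAsHom g)
      (X.applyAsHom g) (fun x => rfl)
      (fun x => Rep.hom_comm_apply (funSum (MonoidHom.id G) X) g x), ih]

end Rep

end

/-! ### Restriction and corestriction for a direct factor -/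

section

universe u

theorem AddMonoidHom.card_mul_of_exact {A B C : Type*} [AddCommGroup A] [AddCommGroup B]
    [AddCommGroup C] {f : A →+ B} {g : B →+ C} (hfg : Function.Exact f g)
    (hf : Function.Injective f) (hg : Function.Surjective g) :
    Nat.card B = Nat.card A * Nat.card C := by
  have h1 : g.ker = f.range := AddSubgroup.ext fun x => hfg x
  rw [AddSubgroup.card_eq_card_quotient_mul_card_addSubgroup g.ker, mul_comm,
    Nat.card_congr (QuotientAddGroup.quotientKerEquivOfSurjective g hg).toEquiv, h1,
    ← Nat.card_congr (AddMonoidHom.ofInjective hf).toEquiv]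

theorem AddMonoidHom.card_mul_of_exact_of_exact {A B C D : Type*} [AddCommGroup A]
    [AddCommGroup B] [AddCommGroup C] [AddCommGroup D] {f : A →+ B} {g : B →+ C} {h : C →+ D}
    (hfg : Function.Exact f g) (hgh : Function.Exact g h)
    (hf : Function.Injective f) (hh : Function.Surjective h) :
    Nat.card A * Nat.card C = Nat.card B * Nat.card D := by
  have h1 : Nat.card B = Nat.card A * Nat.card g.range := by
    refine AddMonoidHom.card_mul_of_exact (g := g.rangeRestrict) (f := f) (fun x => ?_) hf
      g.rangeRestrict_surjective
    rw [← hfg x, ← Subtype.val_inj]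
    rfl
  have h2 : Nat.card C = Nat.card g.range * Nat.card D := by
    refine AddMonoidHom.card_mul_of_exact (f := g.range.subtype) (fun x => ?_)
      Subtype.val_injective hh
    rw [hgh x]
    exact ⟨fun h => ⟨⟨x, h⟩, rfl⟩, by rintro ⟨y, rfl⟩; exact y.2⟩
  rw [h1, h2, mul_assoc]

/-- Discrete integration: the partial sums of `f` solve the equation, and total sum zero lets them
close up at the wrap from `q - 1` to `0`. -/
theorem ZMod.exists_sub_eq {q : ℕ} [NeZero q] {A : Type*} [AddCommGroup A] (f : ZMod q → A)
    (hf : ∑ c, f c = 0) : ∃ h : ZMod q → A, ∀ c, h (c + 1) - h c = f c := by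
  have hs : ∑ j ∈ Finset.range q, f (j : ZMod q) = 0 := by
    rw [← hf]
    refine Finset.sum_bij (fun j _ => (j : ZMod q)) (fun _ _ => Finset.mem_univ _) ?_ ?_
      (fun _ _ => rfl)
    · intro a ha b hb hab
      rw [Finset.mem_range] at ha hb
      rw [← ZMod.val_natCast_of_lt ha, ← ZMod.val_natCast_of_lt hb, hab]
    · exact fun c _ => ⟨c.val, Finset.mem_range.2 c.val_lt, ZMod.natCast_zmod_val c⟩
  refine ⟨fun c => ∑ j ∈ Finset.range c.val, f (j : ZMod q), fun c => ?_⟩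
  have hc : ∑ j ∈ Finset.range (c.val + 1), f (j : ZMod q) =
      ∑ j ∈ Finset.range c.val, f (j : ZMod q) + f c := by
    rw [Finset.sum_range_succ, ZMod.natCast_zmod_val]
  have hcast : ((c.val + 1 : ℕ) : ZMod q) = c + 1 := by
    rw [Nat.cast_add, ZMod.natCast_zmod_val, Nat.cast_one]
  rcases lt_or_eq_of_le (Nat.succ_le_of_lt c.val_lt) with h | h
  · have hv : (c + 1).val = c.val + 1 := by
      rw [← hcast, ZMod.val_natCast_of_lt h]
    simp only [hv, hc, add_sub_cancel_left]
  · have hv : (c + 1).val = 0 := by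
      rw [← hcast, show c.val + 1 = q from h, ZMod.natCast_self, ZMod.val_zero]
    rw [show c.val + 1 = q from h, hs] at hc
    simp only [hv, Finset.range_zero, Finset.sum_empty, zero_sub]
    exact (eq_neg_of_add_eq_zero_right hc.symm).symm

namespace Rep

section

variable {k : Type u} [CommRing k] {G : Type u} [Group G] [Fintype G]
  {Q C : Type u} [Group Q] [Group C] {θ : G →* Q} {χ : G →* C}

/-- In degree `0`, an invariant function is constant because the `C`-direction acts trivially on
`A`. Dimension shifting uses the functions `Q → A`: `ker θ` still acts trivially on them, and the
functions from `C` into them are functions on `Q × C ≃ G`, hence acyclic. -/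
theorem tateMap_funConst_surjective (hE : Function.Bijective (θ.prod χ)) (n : ℕ)
    (A : Rep.{u} k G) (hA : ∀ g, θ g = 1 → ∀ a, A.ρ g a = a) :
    Function.Surjective (tateMap (funConst χ A) n) := by
  induction n generalizing A with
  | zero =>
    refine CochainComplex.homologyMap_surjective (K := tateComplex A)
      (L := tateComplex (funRep χ A)) (tateComplex.map (funConst χ A)) 0 1 rfl fun y hy => ?_
    change (Fin 0 → G) → C → A.V at y
    rw [tateComplex_d_zero_apply_eq_zero_iff] at hy
    have hc (c : C) : y default c = y default 1 := by
      obtain ⟨g, hg⟩ := hE.2 (1, c)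
      rw [MonoidHom.prod_apply, Prod.mk.injEq] at hg
      rw [← hy g, funRep_ρ_apply, hy g, hA g hg.1, map_inv, hg.2, inv_mul_cancel]
    refine ⟨(fun _ => y default 1 : (Fin 0 → G) → A), ?_, ?_⟩
    · rw [tateComplex_d_zero_apply_eq_zero_iff]
      intro g
      have := congrFun (hy g) 1
      rw [funRep_ρ_apply, hc] at this
      exact this
    · refine (tateComplex_map_f_zero _ _).trans ?_
      funext γ c
      rw [Subsingleton.elim γ default, hc c]
      rfl
  | succ n ih =>
    have h := isShortExact_cokerπ _ (funConst_injective θ A)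
    have hY := h.funMap χ
    have := subsingleton_tateCohomology_funRep_funRep θ A χ hE (n + 1)
    intro a
    obtain ⟨b, rfl⟩ := hY.δ_surjective n (n + 1) rfl a
    have hB (g : G) (hg : θ g = 1) (f : Q → A.V) : (funRep θ A).ρ g f = f := by
      funext x
      rw [funRep_ρ_apply, hA g hg, map_inv, hg, inv_one, one_mul]
    obtain ⟨b', rfl⟩ := ih (cokerRep (funConst θ A)) (fun g hg a => by
      obtain ⟨f, rfl⟩ := h.surjective a
      rw [← Rep.hom_comm_apply, hB g hg]) b
    refine ⟨h.δ n (n + 1) rfl b', ?_⟩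
    exact h.δ_naturality hY (funConst χ A) (funConst χ (funRep θ A)) (funConst χ _)
      (fun x => rfl) (fun x => rfl) _ _ _ _

-- Dual to the surjectivity of restriction: degree `-1` is a statement on coinvariants, and lower
-- degrees follow by shifting along the sum map from `Q → A`.
open Representation in
theorem tateMap_funSum_injective [Fintype Q] [Fintype C] (hE : Function.Bijective (θ.prod χ))
    (n : ℕ) (A : Rep.{u} k G) (hA : ∀ g, θ g = 1 → ∀ a, A.ρ g a = a) :
    Function.Injective (tateMap (funSum χ A) (-n - 1)) := by
  classical
  induction n generalizing A with
  | zero =>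
    refine CochainComplex.homologyMap_injective (K := tateComplex (funRep χ A))
      (L := tateComplex A) (tateComplex.map (funSum χ A)) (-2) (-1) rfl fun x y hy => ?_
    change (Fin 0 → G) →₀ (C → A.V) at x
    rw [exists_tateComplex_d_neg_two_eq_iff]
    have hx : (funSum χ A).hom (x default) ∈ Coinvariants.ker A.ρ := by
      rw [tateComplex_map_f_neg_one] at hy
      have := (exists_tateComplex_d_neg_two_eq_iff A _).1 ⟨y, hy⟩
      rwa [Finsupp.single_eq_same] at this
    have hle : Coinvariants.ker A.ρ ≤ (Coinvariants.ker (funRep χ A).ρ).comap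
        (LinearMap.single k (fun _ : C => A.V) 1) := by
      refine Submodule.span_le.2 ?_
      rintro _ ⟨⟨g, a⟩, rfl⟩
      -- `g'` acts on `A` as `g` does but fixes the point `1` of `C`, so the relation `g a - a`
      -- lifts to functions supported at `1`.
      obtain ⟨g', hg'⟩ := hE.2 (θ g, 1)
      rw [MonoidHom.prod_apply, Prod.mk.injEq] at hg'
      have hgg : A.ρ g' a = A.ρ g a := by
        rw [← mul_inv_cancel_left g g', map_mul]
        exact congrArg _ (hA _ (by rw [map_mul, map_inv, hg'.1, inv_mul_cancel]) a)
      refine Coinvariants.mem_ker_of_eq g' (Pi.single 1 a : C → A.V) _ ?_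
      rw [funRep_ρ_single, hg'.2, hgg, mul_one]
      exact (map_sub (LinearMap.single k (fun _ : C => A.V) 1) _ _).symm
    -- Translating along `C` alone moves every value to the point `1`, so a function is equivalent
    -- in the coinvariants to its sum placed at `1`.
    have hsub (c : C) (a : A.V) : (Pi.single c a - Pi.single 1 a : C → A.V) ∈
        Coinvariants.ker (funRep χ A).ρ := by
      obtain ⟨g, hg⟩ := hE.2 (1, c)
      rw [MonoidHom.prod_apply, Prod.mk.injEq] at hg
      refine Coinvariants.mem_ker_of_eq g (Pi.single 1 a : C → A.V) _ ?_
      rw [funRep_ρ_single, hg.2, hA g hg.1, mul_one]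
    have h1 := hle hx
    have h2 := sum_mem fun c (_ : c ∈ (Finset.univ : Finset C)) => hsub c (x default c)
    rw [Finset.sum_sub_distrib, Finset.univ_sum_single] at h2
    have h3 : ∑ c, (Pi.single 1 (x default c) : C → A.V) =
        LinearMap.single k (fun _ : C => A.V) 1 ((funSum χ A).hom (x default)) := by
      rw [funSum_hom_apply, map_sum]
      rfl
    rw [h3] at h2
    have := add_mem h2 h1
    rwa [sub_add_cancel] at this
  | succ n ih =>
    have h := isShortExact_kerι _ (funSum_surjective θ A)
    have hY := h.funMap χ
    have := subsingleton_tateCohomology_funRep_funRep θ A χ hE (-(n + 1 : ℕ) - 1)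
    have hnm : (-(n + 1 : ℕ) - 1 : ℤ) + 1 = -n - 1 := by push_cast; ring
    have hB (g : G) (hg : θ g = 1) (f : Q → A.V) : (funRep θ A).ρ g f = f := by
      funext x
      rw [funRep_ρ_apply, hA g hg, map_inv, hg, inv_one, one_mul]
    have hK := ih (kerRep (funSum θ A)) fun g hg a => Subtype.ext (hB g hg a.1)
    rw [injective_iff_map_eq_zero]
    intro a ha
    apply hY.δ_injective _ _ hnm
    rw [map_zero]
    apply hK
    rw [map_zero, hY.δ_naturality h (funSum χ _) (funSum χ _) (funSum χ A)
      (fun x => (funSum_funMap χ _ x).symm) (fun x => (funSum_funMap χ _ x).symm) _ _ hnm, ha,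
      map_zero]

variable [Fintype C] {A : Rep.{u} k G}

theorem tateMap_funSum_funConst (hC : ∀ a : A, Fintype.card C • a = 0) (n : ℤ)
    (a : tateCohomology A n) : tateMap (funSum χ A) n (tateMap (funConst χ A) n a) = 0 := by
  rw [← tateMap_comp]
  have : funConst χ A ≫ funSum χ A = 0 := by
    ext a
    exact (funSum_funConst χ A a).trans (hC a)
  rw [this, tateMap_zero]

end

end Rep

end

/-! ### Recursions for the orders along a cyclic factor -/

section

namespace Rep

variable {G : Type} [CommGroup G]

section

variable {k : Type} [CommRing k] {q : ℕ} [NeZero q] (χ : G →* Multiplicative (ZMod q))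
  (A : Rep.{0} k G)

/-- The difference operator on functions on `ℤ/q`, with values in the functions of sum zero. -/
noncomputable def funDiff : funRep χ A ⟶ kerRep (funSum χ A) :=
  mkHom
    (LinearMap.codRestrict _
      (LinearMap.funLeft k A.V (· * Multiplicative.ofAdd (1 : ZMod q)) - LinearMap.id) <| by
        intro f
        refine LinearMap.mem_ker.2 ((funSum_hom_apply χ A _).trans ?_)
        refine (Finset.sum_sub_distrib _ _).trans (sub_eq_zero.2 ?_)
        exact Fintype.sum_equiv (Equiv.mulRight (Multiplicative.ofAdd (1 : ZMod q))) _ _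
          fun x => rfl) <| by
    refine fun g f => Subtype.ext (funext fun c => ?_)
    change A.ρ g (f (χ g⁻¹ * (c * _))) - A.ρ g (f (χ g⁻¹ * c)) =
      A.ρ g (f (χ g⁻¹ * c * _) - f (χ g⁻¹ * c))
    rw [map_sub, mul_assoc]

theorem funDiff_apply (f : Multiplicative (ZMod q) → A.V) (c : Multiplicative (ZMod q)) :
    (((funDiff χ A).hom f).1 : Multiplicative (ZMod q) → A.V) c =
      f (c * Multiplicative.ofAdd (1 : ZMod q)) - f c := rfl

/-- This is where `C` must be cyclic: the cokernel of the constants is then again the module of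
functions of sum zero, so both exact sequences share the term `kerRep (funSum χ A)`. -/
theorem isShortExact_funDiff : IsShortExact (funConst χ A) (funDiff χ A) where
  injective := funConst_injective χ A
  exact f := by
    change Multiplicative (ZMod q) → A.V at f
    constructor
    · intro hf
      have h1 (c : Multiplicative (ZMod q)) : f (c * Multiplicative.ofAdd (1 : ZMod q)) = f c := by
        rw [← sub_eq_zero, ← funDiff_apply, hf]
        rfl
      have h2 (j : ℕ) : f (Multiplicative.ofAdd (j : ZMod q)) = f 1 := by
        induction j with
        | zero => rw [Nat.cast_zero, ofAdd_zero]
        | succ j ih => rw [Nat.cast_succ, ofAdd_add, h1, ih]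
      refine ⟨f 1, funext fun c => ?_⟩
      have := h2 (Multiplicative.toAdd c).val
      rw [ZMod.natCast_zmod_val, ofAdd_toAdd] at this
      rw [this]
      rfl
    · rintro ⟨a, rfl⟩
      exact Subtype.ext (funext fun c => sub_self a)
  surjective := by
    rintro ⟨f, hf⟩
    change Multiplicative (ZMod q) → A.V at f
    have hf0 : ∑ c : ZMod q, f (Multiplicative.ofAdd c) = 0 :=
      (Fintype.sum_equiv Multiplicative.ofAdd _ _ fun _ => rfl).trans
        ((funSum_hom_apply χ A f).symm.trans hf)
    obtain ⟨h, hh⟩ := ZMod.exists_sub_eq (fun c => f (Multiplicative.ofAdd c)) hf0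
    exact ⟨fun c => h (Multiplicative.toAdd c), Subtype.ext (funext fun c => hh c.toAdd)⟩

end

variable [Fintype G] {k : Type} [CommRing k] {q : ℕ} [NeZero q] {Q : Type} [Group Q]
  [Fintype Q] {θ : G →* Q} {χ : G →* Multiplicative (ZMod q)} {A : Rep.{0} k G}
  (hE : Function.Bijective (θ.prod χ)) (hA : ∀ g, θ g = 1 → ∀ a, A.ρ g a = a)
  (hq : ∀ a : A, q • a = 0)

include hq in
theorem tateMap_funSum_funConst_eq_zero (n : ℤ) (a : tateCohomology A n) :
    tateMap (funSum χ A) n (tateMap (funConst χ A) n a) = 0 :=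
  tateMap_funSum_funConst (by simpa [ZMod.card] using hq) n a

omit [Fintype Q] in
include hE hA hq in
theorem tateMap_funSum_eq_zero {n : ℤ} (hn : 0 ≤ n) (a : tateCohomology (funRep χ A) n) :
    tateMap (funSum χ A) n a = 0 := by
  lift n to ℕ using hn
  obtain ⟨b, rfl⟩ := tateMap_funConst_surjective hE n A hA a
  exact tateMap_funSum_funConst_eq_zero hq n b

include hE hA in
theorem tateMap_funSum_injective' {n : ℤ} (hn : n ≤ -1) :
    Function.Injective (tateMap (funSum χ A) n) := by
  obtain ⟨j, rfl⟩ : ∃ j : ℕ, n = -j - 1 := ⟨(-n - 1).toNat, by omega⟩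
  exact tateMap_funSum_injective hE j A hA

include hE hA hq in
theorem tateMap_funConst_eq_zero {n : ℤ} (hn : n ≤ -1) (a : tateCohomology A n) :
    tateMap (funConst χ A) n a = 0 := by
  apply tateMap_funSum_injective' hE hA hn
  rw [tateMap_funSum_funConst_eq_zero hq, map_zero]

-- Restriction is onto in degrees `n - 1` and `n`, which cuts a short exact sequence out of the long
-- one. The next lemmas cut in the same way, using where restriction or corestriction is onto,
-- injective or zero.
omit [Fintype Q] in
include hE hA in
theorem card_tateCohomology_of_pos {n : ℤ} (hn : 1 ≤ n) :
    Nat.card (tateCohomology A n) = Nat.card (tateCohomology (kerRep (funSum χ A)) (n - 1)) *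
      Nat.card (tateCohomology (funRep χ A) n) := by
  have h := isShortExact_funDiff χ A
  obtain ⟨j, rfl⟩ : ∃ j : ℕ, n = j + 1 := ⟨(n - 1).toNat, by omega⟩
  refine AddMonoidHom.card_mul_of_exact (h.exact₁ (j + 1 - 1) (j + 1) (by ring)) ?_
    (tateMap_funConst_surjective hE (j + 1) A hA)
  rw [injective_iff_map_eq_zero]
  intro x hx
  obtain ⟨y, rfl⟩ := (h.exact₃ _ _ _ x).1 hx
  have hs : Function.Surjective (tateMap (funConst χ A) (j + 1 - 1)) := by
    rw [add_sub_cancel_right]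
    exact tateMap_funConst_surjective hE j A hA
  obtain ⟨z, rfl⟩ := hs y
  rw [(h.exact₂ _).apply_apply_eq_zero]

omit [Fintype Q] in
include hE hA hq in
theorem card_tateCohomology_kerRep_of_pos {n : ℤ} (hn : 0 ≤ n) :
    Nat.card (tateCohomology (kerRep (funSum χ A)) (n + 1)) = Nat.card (tateCohomology A n) *
      Nat.card (tateCohomology (funRep χ A) (n + 1)) := by
  have h := isShortExact_kerι _ (funSum_surjective χ A)
  refine AddMonoidHom.card_mul_of_exact (h.exact₁ n (n + 1) rfl) ?_ fun x => ?_
  · rw [injective_iff_map_eq_zero]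
    intro x hx
    obtain ⟨y, rfl⟩ := (h.exact₃ _ _ _ x).1 hx
    exact tateMap_funSum_eq_zero hE hA hq hn y
  · exact (h.exact₂ _ x).1 (tateMap_funSum_eq_zero hE hA hq (by omega) x)

-- Between degrees `-1` and `0` corestriction changes from injective to zero, so a four-term exact
-- sequence remains.
include hE hA hq in
theorem card_tateCohomology_kerRep_zero :
    Nat.card (tateCohomology (funRep χ A) (-1)) *
      Nat.card (tateCohomology (kerRep (funSum χ A)) 0) =
      Nat.card (tateCohomology A (-1)) * Nat.card (tateCohomology (funRep χ A) 0) := by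
  have h := isShortExact_kerι _ (funSum_surjective χ A)
  refine AddMonoidHom.card_mul_of_exact_of_exact (h.exact₃ (-1) 0 rfl) (h.exact₁ (-1) 0 rfl)
    (tateMap_funSum_injective' hE hA le_rfl) fun x => ?_
  exact (h.exact₂ _ x).1 (tateMap_funSum_eq_zero hE hA hq le_rfl x)

include hE hA in
theorem card_tateCohomology_of_neg {n : ℤ} (hn : n ≤ -2) :
    Nat.card (tateCohomology A n) = Nat.card (tateCohomology (funRep χ A) n) *
      Nat.card (tateCohomology (kerRep (funSum χ A)) (n + 1)) := by
  have h := isShortExact_kerι _ (funSum_surjective χ A)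
  refine AddMonoidHom.card_mul_of_exact (h.exact₃ n (n + 1) rfl)
    (tateMap_funSum_injective' hE hA (by omega)) fun x => ?_
  refine (h.exact₁ n (n + 1) rfl x).1 ?_
  apply tateMap_funSum_injective' hE hA (by omega)
  rw [(h.exact₂ _).apply_apply_eq_zero, map_zero]

include hE hA hq in
theorem card_tateCohomology_kerRep_of_neg {n : ℤ} (hn : n ≤ -2) :
    Nat.card (tateCohomology (kerRep (funSum χ A)) n) = Nat.card (tateCohomology (funRep χ A) n) *
      Nat.card (tateCohomology A (n + 1)) := by
  have h := isShortExact_funDiff χ A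
  refine AddMonoidHom.card_mul_of_exact (h.exact₃ n (n + 1) rfl) ?_ fun x => ?_
  · rw [injective_iff_map_eq_zero]
    intro x hx
    obtain ⟨y, rfl⟩ := (h.exact₂ _ x).1 hx
    exact tateMap_funConst_eq_zero hE hA hq (by omega) y
  · exact (h.exact₁ _ _ rfl x).1 (tateMap_funConst_eq_zero hE hA hq (by omega) x)

include hE hA hq in
theorem card_tateCohomology_kerRep_neg_one :
    Nat.card (tateCohomology (funRep χ A) (-1)) * Nat.card (tateCohomology A 0) =
      Nat.card (tateCohomology (kerRep (funSum χ A)) (-1)) *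
        Nat.card (tateCohomology (funRep χ A) 0) := by
  have h := isShortExact_funDiff χ A
  refine AddMonoidHom.card_mul_of_exact_of_exact (h.exact₃ (-1) 0 rfl) (h.exact₁ (-1) 0 rfl) ?_
    (tateMap_funConst_surjective hE 0 A hA)
  rw [injective_iff_map_eq_zero]
  intro x hx
  obtain ⟨y, rfl⟩ := (h.exact₂ _ x).1 hx
  exact tateMap_funConst_eq_zero hE hA hq le_rfl y

end Rep

end

/-! ### Tate cohomology of a trivial module of order `p` -/

section

namespace Rep

open Representation

variable {G : Type} [CommGroup G] [Fintype G] {k : Type} [CommRing k]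

theorem card_tateCohomology_zero_of_norm_eq_zero (A : Rep.{0} k G) (hA : ∀ a, A.ρ.norm a = 0) :
    Nat.card (tateCohomology A 0) = Nat.card {a : A // ∀ g, A.ρ g a = a} := by
  refine (CochainComplex.card_homology_of_d_to_eq_zero (K := tateComplex A) (-1) 0 1 rfl rfl
    fun x => ?_).trans ?_
  · exact funext (α := Fin 0 → G) (β := fun _ => A) fun γ =>
      (tateComplex_d_neg_one_apply _ _).trans (hA _)
  · exact Nat.card_congr ((Equiv.funUnique (Fin 0 → G) A).subtypeEquiv fun x =>
      tateComplex_d_zero_apply_eq_zero_iff x)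

theorem card_tateCohomology_neg_one_of_norm_eq_zero (A : Rep.{0} k G)
    (hA : ∀ a, A.ρ.norm a = 0) {F : Type*} [AddCommGroup F] (φ : A.V →+ F)
    (hφ : Function.Surjective φ) (hker : ∀ a, φ a = 0 ↔ a ∈ Coinvariants.ker A.ρ) :
    Nat.card (tateCohomology A (-1)) = Nat.card F := by
  refine CochainComplex.card_homology_of_d_from_eq_zero (K := tateComplex A) (-2) (-1) 0 rfl rfl
    (fun x => ?_) (φ.comp (Finsupp.applyAddHom (M := A.V) (default : Fin 0 → G))) (fun a => ?_)
    fun x => ?_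
  · exact funext (α := Fin 0 → G) (β := fun _ => A) fun γ =>
      (tateComplex_d_neg_one_apply _ _).trans (hA _)
  · obtain ⟨b, rfl⟩ := hφ a
    exact ⟨(Finsupp.single default b : (Fin 0 → G) →₀ A), congrArg φ Finsupp.single_eq_same⟩
  · exact (hker _).trans (exists_tateComplex_d_neg_two_eq_iff A x).symm

/-- In the norm, each coset of the factor `C` contributes `|C|` equal terms. -/
theorem norm_eq_zero {Q C : Type} [Group Q] [Group C] [Fintype C] {θ : G →* Q} {χ : G →* C}
    {A : Rep.{0} k G} (hE : Function.Bijective (θ.prod χ))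
    (hA : ∀ g, θ g = 1 → ∀ a, A.ρ g a = a) (hC : ∀ a : A, Fintype.card C • a = 0) (a : A) :
    A.ρ.norm a = 0 := by
  let E := MulEquiv.ofBijective _ hE
  have : Fintype Q := @Fintype.ofFinite Q (Finite.of_surjective θ fun x => by
    obtain ⟨g, hg⟩ := hE.2 (x, 1)
    exact ⟨g, congrArg Prod.fst hg⟩)
  have h (x : Q) (c : C) : A.ρ (E.symm (x, c)) a = A.ρ (E.symm (x, 1)) a := by
    rw [show (x, c) = (x, 1) * ((1, c) : Q × C) by simp, map_mul, map_mul, Module.End.mul_apply,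
      hA (E.symm (1, c))]
    exact congrArg Prod.fst (E.apply_symm_apply (1, c))
  rw [Representation.norm, LinearMap.sum_apply,
    ← Fintype.sum_equiv E.symm.toEquiv (fun x => A.ρ (E.symm x) a) _ fun x => rfl,
    Fintype.sum_prod_type]
  refine Finset.sum_eq_zero fun x _ => ?_
  rw [Finset.sum_congr rfl fun c _ => h x c, Finset.sum_const]
  exact hC _

section

variable {P : Type} [Group P] [Fintype P] {π : G →* P} (hπ : Function.Surjective π)
  {F : Rep.{0} k G} (hF : ∀ g a, F.ρ g a = a)

omit [Fintype G] [Fintype P] in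
include hπ hF in
theorem card_invariants_funRep :
    Nat.card {f : funRep π F // ∀ g, (funRep π F).ρ g f = f} = Nat.card F := by
  refine (Nat.card_congr (Equiv.ofBijective (fun a : F => (⟨(funConst π F).hom a, fun g => ?_⟩ :
    {f : funRep π F // ∀ g, (funRep π F).ρ g f = f})) ⟨fun a b hab => ?_, ?_⟩)).symm
  · rw [← Rep.hom_comm_apply, hF]
  · exact funConst_injective π F (congrArg Subtype.val hab)
  · rintro ⟨f, hf⟩
    change P → F.V at f
    refine ⟨f 1, Subtype.ext (funext fun x => ?_)⟩
    obtain ⟨g, rfl⟩ := hπ x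
    have := congrFun (hf g) (π g)
    rw [funRep_ρ_apply, hF, map_inv, inv_mul_cancel] at this
    exact this

omit [Fintype G] in
include hπ hF in
theorem funSum_eq_zero_iff_mem_coinvariants_ker (f : P → F.V) :
    (funSum π F).hom f = 0 ↔ f ∈ Coinvariants.ker (funRep π F).ρ := by
  classical
  constructor
  · intro h
    have hsub (x : P) (a : F.V) : (Pi.single x a - Pi.single 1 a : P → F.V) ∈
        Coinvariants.ker (funRep π F).ρ := by
      obtain ⟨g, rfl⟩ := hπ x
      refine Coinvariants.mem_ker_of_eq g (Pi.single 1 a : P → F.V) _ ?_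
      rw [funRep_ρ_single, hF, mul_one]
    have h2 := sum_mem fun c (_ : c ∈ (Finset.univ : Finset P)) => hsub c (f c)
    have h3 : ∑ c, (Pi.single 1 (f c) : P → F.V) = 0 := by
      refine (map_sum (LinearMap.single k (fun _ : P => F.V) 1) _ _).symm.trans ?_
      rw [← funSum_hom_apply π F f, h, map_zero]
    rwa [Finset.sum_sub_distrib, Finset.univ_sum_single, h3, sub_zero] at h2
  · intro h
    have hle : Coinvariants.ker (funRep π F).ρ ≤
        LinearMap.ker (funSum π F).hom.toLinearMap := by
      refine Submodule.span_le.2 ?_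
      rintro _ ⟨⟨g, f⟩, rfl⟩
      change (funSum π F).hom ((funRep π F).ρ g f - f) = 0
      rw [map_sub, Rep.hom_comm_apply, hF, sub_self]
    exact hle h

end

/-- The dimension over `𝔽_p` of the `n`-th Tate cohomology of `𝔽_p` for a product of `r` nontrivial
cyclic `p`-groups. -/
def tateRank (r : ℕ) (n : ℤ) : ℕ :=
  if r = 0 then 0 else if 0 ≤ n then r.multichoose n.toNat else r.multichoose (-n - 1).toNat

theorem tateRank_of_nonneg {r : ℕ} (hr : r ≠ 0) (n : ℕ) : tateRank r n = r.multichoose n := by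
  simp [tateRank, hr]

theorem tateRank_of_neg {r : ℕ} (hr : r ≠ 0) (n : ℕ) :
    tateRank r (-n - 1) = r.multichoose n := by
  rw [tateRank, if_neg hr, if_neg (by omega)]
  congr 1
  omega

/-- The trivial group is a separate case because `Nat.multichoose 0 0 = 1`, while its Tate
cohomology vanishes even in degrees `0` and `-1`. -/
theorem tateRank_zero (n : ℤ) : tateRank 0 n = 0 := rfl

theorem multichoose_recursion (r n : ℕ) :
    (r + 1).multichoose (n + 2) =
      (r + 1).multichoose n + r.multichoose (n + 1) + r.multichoose (n + 2) := by
  rw [Nat.multichoose_succ_succ, Nat.multichoose_succ_succ]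
  ring

theorem tateRank_succ_of_nonneg (r n : ℕ) :
    tateRank (r + 1) (n + 2) =
      tateRank (r + 1) n + tateRank r (n + 1) + tateRank r (n + 2) := by
  have h := multichoose_recursion r n
  rw [show (n + 2 : ℤ) = ((n + 2 : ℕ) : ℤ) by push_cast; ring,
    show (n + 1 : ℤ) = ((n + 1 : ℕ) : ℤ) by push_cast; ring,
    tateRank_of_nonneg r.succ_ne_zero, tateRank_of_nonneg r.succ_ne_zero, h]
  rcases Nat.eq_zero_or_pos r with rfl | hr
  · simp [tateRank_zero, Nat.multichoose_zero_succ]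
  · rw [tateRank_of_nonneg hr.ne', tateRank_of_nonneg hr.ne']

theorem tateRank_neg (r : ℕ) (n : ℤ) : tateRank r (-n - 1) = tateRank r n := by
  rcases Nat.eq_zero_or_pos r with rfl | hr
  · rfl
  rcases le_or_gt 0 n with h | h
  · lift n to ℕ using h
    rw [tateRank_of_nonneg hr.ne', tateRank_of_neg hr.ne']
  · obtain ⟨j, rfl⟩ : ∃ j : ℕ, n = -j - 1 := ⟨(-n - 1).toNat, by omega⟩
    rw [tateRank_of_neg hr.ne', show (-(-(j : ℤ) - 1) - 1) = j by ring,
      tateRank_of_nonneg hr.ne']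

theorem tateRank_succ_zero (r : ℕ) : tateRank (r + 1) 0 = 1 := by
  simpa using tateRank_of_nonneg r.succ_ne_zero 0

theorem tateRank_succ_one (r : ℕ) : tateRank (r + 1) 1 = 1 + tateRank r 1 := by
  have h := tateRank_of_nonneg r.succ_ne_zero 1
  rw [Nat.cast_one] at h
  rw [h, Nat.multichoose_one_right]
  rcases Nat.eq_zero_or_pos r with rfl | hr
  · rfl
  · have h := tateRank_of_nonneg hr.ne' 1
    rw [Nat.cast_one] at h
    rw [h, Nat.multichoose_one_right, add_comm]

/-- Functions on `P` stand for the subgroup `ker π`, a product of `r` cyclic groups, so that the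
induction on `r` never changes `G`. With no factor left the module is acyclic. Otherwise one factor
`C` is singled out: functions on `P × C` have rank `r` by induction, and the recursions along `C`
give rank `r + 1` for functions on `P`. -/
theorem card_tateCohomology_funRep {p : ℕ} (hp : p ≠ 0) {F : Rep.{0} k G}
    (hF : ∀ g a, F.ρ g a = a) (hcard : Nat.card F = p) (r : ℕ) {P : Type} [Group P] [Fintype P]
    (q : Fin r → ℕ) [∀ i, NeZero (q i)] (hq : ∀ i, p ∣ q i) (π : G →* P)
    (χ : ∀ i, G →* Multiplicative (ZMod (q i)))
    (hE : Function.Bijective (π.prod (MonoidHom.pi χ))) (n : ℤ) :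
    Nat.card (tateCohomology (funRep π F) n) = p ^ tateRank r n := by
  induction r generalizing P n with
  | zero =>
    have hπ : Function.Bijective π := by
      have : Function.Bijective (Prod.fst : P × (∀ i : Fin 0, Multiplicative (ZMod (q i))) → P) :=
        ⟨fun a b h => Prod.ext h (Subsingleton.elim _ _), fun x => ⟨(x, 1), rfl⟩⟩
      exact this.comp hE
    have := subsingleton_tateCohomology_funRep π F hπ n
    rw [tateRank_zero, pow_zero, Nat.card_unique]
  | succ r ih =>
    let θ : G →* P × (∀ i : Fin r, Multiplicative (ZMod (q i.succ))) :=
      π.prod (MonoidHom.pi fun i => χ i.succ)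
    have hE' : Function.Bijective (θ.prod (χ 0)) := by
      constructor
      · intro g g' h
        simp only [θ, MonoidHom.prod_apply, Prod.mk.injEq] at h
        refine hE.1 (Prod.ext h.1.1 (funext fun i => ?_))
        exact Fin.cases h.2 (fun i => congrFun h.1.2 i) i
      · rintro ⟨⟨x, c⟩, c0⟩
        obtain ⟨g, hg⟩ := hE.2 (x, Fin.cons (α := fun i => Multiplicative (ZMod (q i))) c0 c)
        rw [MonoidHom.prod_apply, Prod.mk.injEq] at hg
        refine ⟨g, ?_⟩
        simp only [θ, MonoidHom.prod_apply, Prod.mk.injEq]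
        exact ⟨⟨hg.1, funext fun i => congrFun hg.2 i.succ⟩, congrFun hg.2 0⟩
    have hE'' : Function.Bijective ((π.prod (χ 0)).prod (MonoidHom.pi fun i : Fin r => χ i.succ)) := by
      constructor
      · intro g g' h
        simp only [MonoidHom.prod_apply, Prod.mk.injEq] at h
        exact hE'.1 (Prod.ext (Prod.ext h.1.1 h.2) h.1.2)
      · rintro ⟨⟨x, c0⟩, c⟩
        obtain ⟨g, hg⟩ := hE'.2 ((x, c), c0)
        simp only [θ, MonoidHom.prod_apply, Prod.mk.injEq] at hg
        exact ⟨g, Prod.ext (Prod.ext hg.1.1 hg.2) hg.1.2⟩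
    have hA (g : G) (hg : θ g = 1) (f : P → F.V) : (funRep π F).ρ g f = f := by
      funext x
      rw [funRep_ρ_apply, hF, map_inv, show π g = 1 from congrArg Prod.fst hg, inv_one, one_mul]
    have hpF (a : F) : p • a = 0 := by
      rw [← hcard]
      exact card_nsmul_eq_zero'
    have hqA (f : P → F.V) : q 0 • f = 0 := by
      obtain ⟨c, hc⟩ := hq 0
      funext x
      change q 0 • f x = 0
      rw [hc, mul_comm, mul_nsmul, hpF]
    have hπ : Function.Surjective π := fun x => by
      obtain ⟨g, hg⟩ := hE.2 (x, 1)
      exact ⟨g, congrArg Prod.fst hg⟩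
    have hY (n : ℤ) : Nat.card (tateCohomology (funRep (χ 0) (funRep π F)) n) =
        p ^ tateRank r n := by
      rw [← ih (fun i => q i.succ) (fun i => hq _) (π.prod (χ 0)) (fun i => χ i.succ) hE'' n]
      exact (Nat.card_congr (tateEquiv _ (funCurry_bijective π F (χ 0)) n).toEquiv).symm
    have hnorm (f : P → F.V) : (funRep π F).ρ.norm f = 0 :=
      norm_eq_zero (A := funRep π F) hE' hA (by simpa [ZMod.card] using hqA) f
    have h0 : Nat.card (tateCohomology (funRep π F) 0) = p := by
      rw [card_tateCohomology_zero_of_norm_eq_zero _ hnorm, card_invariants_funRep hπ hF, hcard]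
    have h1 : Nat.card (tateCohomology (funRep π F) (-1)) = p := by
      rw [card_tateCohomology_neg_one_of_norm_eq_zero _ hnorm
        (funSum π F).hom.toLinearMap.toAddMonoidHom (funSum_surjective π F)
        (funSum_eq_zero_iff_mem_coinvariants_ker hπ hF), hcard]
    have hpos (a : ℕ) : 0 < p ^ a := pow_pos (Nat.pos_of_ne_zero hp) a
    have hneg1 : tateRank r (-1) = tateRank r 0 := tateRank_neg r 0
    -- Eliminating the sum-zero module gives a recursion of step two, so degrees `0, -1` and `1, -2`
    -- are the base cases.
    have key (j : ℕ) : Nat.card (tateCohomology (funRep π F) j) = p ^ tateRank (r + 1) j ∧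
        Nat.card (tateCohomology (funRep π F) (-j - 1)) = p ^ tateRank (r + 1) j := by
      induction j using Nat.strong_induction_on with
      | _ j ihj =>
      rcases j with _ | _ | j
      · simp only [Nat.cast_zero, neg_zero, zero_sub, tateRank_succ_zero, pow_one]
        exact ⟨h0, h1⟩
      · rw [zero_add, Nat.cast_one, tateRank_succ_one]
        constructor
        · have e1 := card_tateCohomology_of_pos (A := funRep π F) hE' hA (le_refl 1)
          have e2 := card_tateCohomology_kerRep_zero (A := funRep π F) hE' hA hqA
          rw [sub_self] at e1
          rw [hY, h1, hY, hneg1, mul_comm] at e2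
          -- The functions on `P × C` have cohomology of the same order in degrees `-1` and `0`, so
          -- this factor cancels.
          have e3 := Nat.eq_of_mul_eq_mul_right (hpos _) e2
          rw [e1, e3, hY, pow_add, pow_one]
        · have e1 := card_tateCohomology_of_neg (A := funRep π F) hE' hA (le_refl (-2))
          have e2 := card_tateCohomology_kerRep_neg_one (A := funRep π F) hE' hA hqA
          rw [hY, h0, hY, hneg1, mul_comm] at e2
          have e3 := Nat.eq_of_mul_eq_mul_right (hpos _) e2
          rw [show (-1 - 1 : ℤ) = -2 by norm_num, e1, hY, show (-2 + 1 : ℤ) = -1 by norm_num,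
            ← e3, show (-2 : ℤ) = -1 - 1 by norm_num, tateRank_neg, pow_add, pow_one, mul_comm]
      · obtain ⟨i1, i2⟩ := ihj j (by omega)
        rw [show ((j + 1 + 1 : ℕ) : ℤ) = j + 2 by push_cast; ring, tateRank_succ_of_nonneg]
        constructor
        · rw [card_tateCohomology_of_pos hE' hA (by omega),
            show (j + 2 - 1 : ℤ) = j + 1 by ring,
            card_tateCohomology_kerRep_of_pos hE' hA hqA (by omega), i1, hY, hY, pow_add, pow_add]
        · rw [card_tateCohomology_of_neg hE' hA (by omega),
            card_tateCohomology_kerRep_of_neg hE' hA hqA (by omega),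
            show (-(j + 2 : ℤ) - 1 + 1 + 1) = -j - 1 by ring, i2, hY, hY,
            show (-(j + 2 : ℤ) - 1 + 1) = -(j + 1) - 1 by ring, tateRank_neg, tateRank_neg,
            pow_add, pow_add]
          ring
    rcases le_or_gt 0 n with h | h
    · lift n to ℕ using h
      exact (key n).1
    · obtain ⟨j, rfl⟩ : ∃ j : ℕ, n = -j - 1 := ⟨(-n - 1).toNat, by omega⟩
      rw [tateRank_neg]
      exact (key j).2

/-- The order of the Tate cohomology of a trivial module of order `p` for a product of `s` nontrivial
cyclic `p`-groups. -/
theorem card_tateCohomology_trivial {p : ℕ} (hp : p.Prime) {s : ℕ} (m : Fin s → ℕ)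
    (hm : ∀ i, 0 < m i) (e : G ≃* ((i : Fin s) → Multiplicative (ZMod (p ^ m i))))
    {F : Rep.{0} k G} (hF : ∀ g a, F.ρ g a = a) (hcard : Nat.card F = p) (n : ℤ) :
    Nat.card (tateCohomology F n) = p ^ tateRank s n := by
  have (i : Fin s) : NeZero (p ^ m i) := ⟨pow_ne_zero _ hp.ne_zero⟩
  -- Functions on a point are `F` itself.
  rw [← card_tateCohomology_funRep (P := Unit) hp.ne_zero hF hcard s (fun i => p ^ m i)
    (fun i => dvd_pow_self p (hm i).ne') 1 (fun i => (Pi.evalMonoidHom _ i).comp e.toMonoidHom) ?_ n]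
  · refine Nat.card_congr (tateEquiv (funConst (P := Unit) 1 F)
      ⟨funConst_injective _ F, fun f => ?_⟩ n).toEquiv
    exact ⟨f (), rfl⟩
  · constructor
    · intro g g' h
      exact e.injective (congrArg Prod.snd h)
    · rintro ⟨_, c⟩
      obtain ⟨g, rfl⟩ := e.surjective c
      exact ⟨g, rfl⟩

end Rep

end

/-! ### The cokernel of `z - 1` for an automorphism `z` of order `p ^ j` -/

section

open Polynomial

theorem Polynomial.exists_aeval_eq_sub_one_mul_add {R : Type*} [Ring R] (z : R) (P : ℤ[X]) :
    ∃ Q : ℤ[X], aeval z P = (z - 1) * aeval z Q + (P.eval 1 : ℤ) := by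
  obtain ⟨Q, hQ⟩ := Polynomial.X_sub_C_dvd_sub_C_eval (a := (1 : ℤ)) (p := P)
  refine ⟨Q, ?_⟩
  have := congrArg (aeval z) hQ
  rw [map_sub, map_mul, map_sub, aeval_X, aeval_C, aeval_C, map_one, sub_eq_iff_eq_add] at this
  rw [this]
  simp

variable {M : Type*} [AddCommGroup M] {p j : ℕ} {z : Module.End ℤ M}

/-- The power `w` of `z` has order `p` and `w - 1` is injective, so `1 + w + ⋯ + w ^ (p - 1) = 0`.
This is the `p ^ j`-th cyclotomic polynomial at `z`; its value at `1` is `p`, so `p` is a multiple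
of `z - 1`. -/
theorem Module.End.exists_sub_one_mul_eq_prime (hp : p.Prime) (hj : 0 < j)
    (hz : orderOf z = p ^ j)
    (hinj : ∀ P : ℤ[X], aeval z P ≠ 0 → Function.Injective (aeval z P)) :
    ∃ Q : ℤ[X], (z - 1) * aeval z Q = (p : Module.End ℤ M) := by
  let w := z ^ p ^ (j - 1)
  have hwp : w ^ p = 1 := by
    rw [← pow_mul, ← pow_succ, Nat.sub_add_cancel hj, ← hz, pow_orderOf_eq_one]
  have hw1 : w - 1 ≠ 0 := by
    rw [sub_ne_zero]
    refine pow_ne_one_of_lt_orderOf (pow_ne_zero _ hp.ne_zero) ?_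
    rw [hz]
    exact Nat.pow_lt_pow_right hp.one_lt (by omega)
  have hw : aeval z (X ^ p ^ (j - 1) - 1 : ℤ[X]) = w - 1 := by simp [w]
  have hwinj : Function.Injective (w - 1 : Module.End ℤ M) := by
    rw [← hw] at hw1 ⊢
    exact hinj _ hw1
  have hsum : ∑ i ∈ Finset.range p, w ^ i = 0 := by
    ext x
    apply hwinj
    rw [← Module.End.mul_apply, mul_geom_sum, hwp, sub_self]
    simp
  obtain ⟨Q, hQ⟩ := Polynomial.exists_aeval_eq_sub_one_mul_add z
    (∑ i ∈ Finset.range p, (X ^ p ^ (j - 1)) ^ i)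
  refine ⟨-Q, ?_⟩
  simp only [map_sum, map_pow, aeval_X, eval_finsetSum, eval_pow, eval_X, one_pow,
    Finset.sum_const, Finset.card_range, nsmul_eq_mul, mul_one] at hQ
  change ∑ i ∈ Finset.range p, w ^ i = _ at hQ
  rw [hsum, Int.cast_natCast] at hQ
  rw [map_neg, mul_neg, neg_eq_iff_add_eq_zero, add_comm]
  rw [add_comm] at hQ
  exact hQ.symm

/-- Modulo `p`, `(z - 1) ^ (p ^ j)` equals `z ^ (p ^ j) - 1 = 0`. Surjectivity of `z - 1` would give
`M = p M`, impossible for a nonzero free module. -/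
theorem Module.End.not_surjective_sub_one [Module.Free ℤ M] (hp : p.Prime) (hj : 0 < j)
    (hz : orderOf z = p ^ j) : ¬ Function.Surjective (z - 1 : Module.End ℤ M) := by
  intro hs
  have hne : Nontrivial M := by
    by_contra h
    rw [not_nontrivial_iff_subsingleton] at h
    have h1 : z = 1 := LinearMap.ext fun x => Subsingleton.elim _ _
    rw [h1, orderOf_one] at hz
    exact (Nat.one_lt_pow hj.ne' hp.one_lt).ne hz
  obtain ⟨r, hr⟩ := (Commute.one_right (z - 1)).exists_add_pow_prime_pow_eq hp j
  rw [sub_add_cancel, ← hz, pow_orderOf_eq_one, one_pow, mul_one] at hr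
  have h1 (x : M) : ∃ y, x = p • y := by
    have hsp : Function.Surjective ((z - 1) ^ orderOf z : Module.End ℤ M) := by
      rw [Module.End.coe_pow]
      exact hs.iterate _
    obtain ⟨x', rfl⟩ := hsp x
    refine ⟨-((z - 1) * r) x', ?_⟩
    have := LinearMap.congr_fun hr x'
    rw [mul_assoc] at this
    simp only [LinearMap.add_apply, Module.End.one_apply, Module.End.mul_apply (p : Module.End ℤ M),
      Module.End.natCast_apply] at this
    rw [smul_neg, ← add_eq_zero_iff_eq_neg]
    have h2 : x' + (((z - 1) ^ orderOf z) x' + p • ((z - 1) * r) x') = x' + 0 := by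
      rw [add_zero]
      conv_rhs => rw [this]
      abel
    exact add_left_cancel h2
  let b := Module.Free.chooseBasis ℤ M
  obtain ⟨i⟩ := b.index_nonempty
  obtain ⟨y, hy⟩ := h1 (b i)
  have := congrArg (fun x => b.repr x i) hy
  simp only [Module.Basis.repr_self, Finsupp.single_eq_same, map_nsmul, Finsupp.smul_apply,
    nsmul_eq_mul] at this
  have hu : IsUnit (p : ℤ) := IsUnit.of_mul_eq_one _ this.symm
  exact hp.one_lt.ne' (by simpa [Int.isUnit_iff_natAbs_eq] using hu)

/-- Since `z - 1` is injective, its image has the same index in `M` as in the finite-index submodule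
`N = ℤ[z] v`. There the quotient is generated by the class of `v`, which `p` kills, so the index
divides `p`; it is not `1` because `z - 1` is not surjective. -/
theorem Module.End.card_quotient_range_sub_one [Module.Free ℤ M] (hp : p.Prime) (hj : 0 < j)
    (hz : orderOf z = p ^ j)
    (hinj : ∀ P : ℤ[X], aeval z P ≠ 0 → Function.Injective (aeval z P)) (v : M)
    (N : AddSubgroup M) (hN : ∀ x, x ∈ N ↔ ∃ P : ℤ[X], aeval z P v = x) (hfin : N.index ≠ 0) :
    Nat.card (M ⧸ LinearMap.range (z - 1)) = p := by
  obtain ⟨Q, hQ⟩ := Module.End.exists_sub_one_mul_eq_prime hp hj hz hinj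
  have hπ : Function.Injective (z - 1).toAddMonoidHom := by
    have h0 : z - 1 ≠ 0 := by
      rw [sub_ne_zero]
      rintro rfl
      rw [orderOf_one] at hz
      exact (Nat.one_lt_pow hj.ne' hp.one_lt).ne hz
    have h1 : aeval z (X - 1 : ℤ[X]) = z - 1 := by simp
    rw [← h1] at h0
    have := hinj _ h0
    rwa [h1] at this
  let K := N.map (z - 1).toAddMonoidHom
  have hKN : K ≤ N := by
    rintro _ ⟨x, hx, rfl⟩
    obtain ⟨P, rfl⟩ := (hN x).1 hx
    exact (hN _).2 ⟨(X - 1) * P, by simp⟩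
  have h1 : K.relIndex N * N.index = K.index := AddSubgroup.relIndex_mul_index hKN
  have h2 := AddSubgroup.relIndex_mul_index
    (AddSubgroup.map_mono (f := (z - 1).toAddMonoidHom) (le_top : N ≤ ⊤))
  rw [AddSubgroup.relIndex_map_map_of_injective _ _ hπ, AddSubgroup.relIndex_top_right] at h2
  have h3 : K.relIndex N = (AddSubgroup.map (z - 1).toAddMonoidHom ⊤).index := by
    rw [mul_comm] at h1
    exact Nat.eq_of_mul_eq_mul_left (Nat.pos_of_ne_zero hfin) (h1.trans h2.symm)
  have h4 : (AddSubgroup.map (z - 1).toAddMonoidHom ⊤).index =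
      Nat.card (M ⧸ LinearMap.range (z - 1)) := by
    have : AddSubgroup.map (z - 1).toAddMonoidHom ⊤ = (LinearMap.range (z - 1)).toAddSubgroup := by
      ext x
      simp
    rw [this]
    rfl
  have hv : v ∈ N := (hN v).2 ⟨1, by simp⟩
  have h5 : K.relIndex N ∣ p := by
    let v' : N ⧸ K.addSubgroupOf N := QuotientAddGroup.mk ⟨v, hv⟩
    have hgen (x : N ⧸ K.addSubgroupOf N) : x ∈ AddSubgroup.zmultiples v' := by
      induction x using QuotientAddGroup.induction_on with
      | H x =>
        obtain ⟨x, hx⟩ := x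
        obtain ⟨P, rfl⟩ := (hN x).1 hx
        obtain ⟨P', hP'⟩ := Polynomial.exists_aeval_eq_sub_one_mul_add z P
        refine ⟨P.eval 1, ?_⟩
        change ((P.eval 1 • (⟨v, hv⟩ : N) : N) : N ⧸ K.addSubgroupOf N) = _
        rw [QuotientAddGroup.eq, AddSubgroup.mem_addSubgroupOf]
        refine ⟨aeval z P' v, (hN _).2 ⟨P', rfl⟩, ?_⟩
        have := LinearMap.congr_fun hP' v
        simp only [AddSubgroup.coe_add, AddSubgroup.coe_neg, AddSubgroup.coe_zsmul]
        rw [this, LinearMap.add_apply, Module.End.intCast_apply, add_comm, add_neg_cancel_right]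
        rfl
    have hcard : Nat.card (N ⧸ K.addSubgroupOf N) = addOrderOf v' := by
      rw [← Nat.card_zmultiples, (AddSubgroup.eq_top_iff' _).2 hgen]
      exact Nat.card_congr AddSubgroup.topEquiv.symm.toEquiv
    change Nat.card (N ⧸ K.addSubgroupOf N) ∣ p
    rw [hcard, addOrderOf_dvd_iff_nsmul_eq_zero]
    change ((p • (⟨v, hv⟩ : N) : N) : N ⧸ K.addSubgroupOf N) = 0
    rw [QuotientAddGroup.eq_zero_iff, AddSubgroup.mem_addSubgroupOf]
    refine ⟨aeval z Q v, (hN _).2 ⟨Q, rfl⟩, ?_⟩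
    have := LinearMap.congr_fun hQ v
    rw [Module.End.natCast_apply] at this
    exact this
  rw [← h4, ← h3]
  refine ((Nat.dvd_prime hp).1 h5).resolve_left fun h6 => ?_
  rw [h3, AddSubgroup.index_eq_one] at h6
  refine Module.End.not_surjective_sub_one hp hj hz fun x => ?_
  have : x ∈ AddSubgroup.map (z - 1).toAddMonoidHom ⊤ := by
    rw [h6]
    exact AddSubgroup.mem_top x
  obtain ⟨y, -, hy⟩ := this
  exact ⟨y, hy⟩

end

/-! ### Elementary abelian groups, duals of groups of order `p`, and the numbers `ν` -/

section

theorem nonempty_addEquiv_fin_zmod_of_module {p : ℕ} [hp : Fact p.Prime] {H : Type*}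
    [AddCommGroup H] [Module (ZMod p) H] {d : ℕ} (hd : Nat.card H = p ^ d) :
    Nonempty (H ≃+ (Fin d → ZMod p)) := by
  have : Finite H := Nat.finite_of_card_ne_zero (by rw [hd]; exact pow_ne_zero _ hp.1.ne_zero)
  have h := FiniteField.pow_finrank_eq_natCard p H
  rw [hd] at h
  have hr : Module.finrank (ZMod p) H = d := Nat.pow_right_injective hp.1.two_le h
  exact ⟨(Module.finBasisOfFinrankEq (ZMod p) H hr).equivFun.toAddEquiv⟩

theorem nonempty_addEquiv_fin_zmod {p : ℕ} (hp : p.Prime) {H : Type*} [AddCommGroup H]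
    (hH : ∀ x : H, p • x = 0) {d : ℕ} (hd : Nat.card H = p ^ d) :
    Nonempty (H ≃+ (Fin d → ZMod p)) :=
  have := Fact.mk hp
  let _ : Module (ZMod p) H := AddCommGroup.zmodModule hH
  nonempty_addEquiv_fin_zmod_of_module hd

theorem card_prime_torsion_addCircle {p : ℕ} (hp : 0 < p) :
    Nat.card {t : AddCircle (1 : ℚ) // p • t = 0} = p := by
  have hp' : (p : ℚ) ≠ 0 := by exact_mod_cast hp.ne'
  let t₀ : AddCircle (1 : ℚ) := ((1 / p : ℚ) : AddCircle (1 : ℚ))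
  have h0 : addOrderOf t₀ = p := AddCircle.addOrderOf_period_div hp
  conv_rhs => rw [← h0, ← Nat.card_zmultiples]
  refine Nat.card_congr (Equiv.subtypeEquivRight fun t => ?_)
  constructor
  · intro ht
    induction t using QuotientAddGroup.induction_on with
    | H x =>
      have ht' : ((p * x : ℚ) : AddCircle (1 : ℚ)) = 0 := by
        rw [← nsmul_eq_mul]
        exact ht
      obtain ⟨n, hn⟩ := (AddCircle.coe_eq_zero_iff (1 : ℚ)).1 ht'
      refine ⟨n, ?_⟩
      change n • ((1 / p : ℚ) : AddCircle (1 : ℚ)) = (x : AddCircle (1 : ℚ))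
      rw [← AddCircle.coe_zsmul]
      congr 1
      rw [zsmul_eq_mul, mul_one] at hn
      rw [zsmul_eq_mul]
      field_simp
      exact hn
  · rintro ⟨n, rfl⟩
    change p • n • t₀ = 0
    rw [smul_comm, ← h0, addOrderOf_nsmul_eq_zero, smul_zero]

/-- A homomorphism from `H ≃ ℤ/p` is the choice of a `p`-torsion element of `ℚ/ℤ`. -/
theorem card_linearMap_addCircle_of_card_eq_prime {p : ℕ} (hp : p.Prime) {H : Type*}
    [AddCommGroup H] (hH : Nat.card H = p) :
    Nat.card (H →ₗ[ℤ] AddCircle (1 : ℚ)) = p := by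
  have hpH (x : H) : p • x = 0 := by
    rw [← hH]
    exact card_nsmul_eq_zero'
  obtain ⟨E⟩ := nonempty_addEquiv_fin_zmod hp hpH (d := 1) (by rw [hH, pow_one])
  let E' : H ≃+ ZMod p := E.trans (AddEquiv.funUnique (Fin 1) (ZMod p))
  conv_rhs => rw [← card_prime_torsion_addCircle hp.pos]
  let e1 : (H →ₗ[ℤ] AddCircle (1 : ℚ)) ≃ (H →+ AddCircle (1 : ℚ)) :=
    (addMonoidHomLequivInt ℤ).symm.toEquiv
  let e2 : (H →+ AddCircle (1 : ℚ)) ≃ (ZMod p →+ AddCircle (1 : ℚ)) :=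
    (AddEquiv.addMonoidHomCongrLeft E').toEquiv
  let e3 : (ℤ →+ AddCircle (1 : ℚ)) ≃ AddCircle (1 : ℚ) := (zmultiplesHom _).symm
  refine Nat.card_congr (e1.trans (e2.trans ((ZMod.lift p).symm.trans
    (e3.subtypeEquiv fun f => ?_))))
  change f (p : ℤ) = 0 ↔ p • f 1 = 0
  rw [← map_nsmul, nsmul_eq_mul, mul_one]

theorem Int.ringMultichoose_natCast (s n : ℕ) :
    Ring.multichoose (s : ℤ) n = (s.multichoose n : ℤ) := by
  induction s generalizing n with
  | zero =>
    cases n with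
    | zero => simp
    | succ n => simp [Ring.multichoose_zero_succ]
  | succ s ih =>
    induction n with
    | zero => simp
    | succ n ihn =>
      rw [Nat.cast_succ] at ihn ⊢
      rw [Ring.multichoose_succ_succ, ih, ihn, Nat.multichoose_succ_succ, Nat.cast_add]

/-- The last summand is `binom(-s, n) = (-1)ⁿ multichoose s n`, and the sign in front of the others
flips. -/
theorem nu_natCast (n s : ℕ) : nu n s = s.multichoose n - nu (n - 1) s := by
  have h1 : (n : ℤ).negOnePow * (n : ℤ).negOnePow = 1 := Int.units_mul_self _
  have h1' : ((n : ℤ).negOnePow : ℤ) * ((n : ℤ).negOnePow : ℤ) = 1 := by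
    rw [← Units.val_mul, h1, Units.val_one]
  have h2 : ((n - 1 : ℤ).negOnePow : ℤ) = -((n : ℤ).negOnePow : ℤ) := by
    have := Int.negOnePow_succ ((n : ℤ) - 1)
    rw [sub_add_cancel] at this
    rw [this]
    simp
  have h3 : Ring.choose (-(s : ℤ)) n = ((n : ℤ).negOnePow : ℤ) * s.multichoose n := by
    rw [Ring.choose_neg', Units.smul_def, smul_eq_mul]
    exact congrArg _ (Int.ringMultichoose_natCast s n)
  rw [nu, nu, show ((n : ℤ) + 1).toNat = n + 1 by omega, show ((n : ℤ) - 1 + 1).toNat = n by omega,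
    Finset.sum_range_succ, mul_add, h3, ← mul_assoc, h1', h2]
  ring

/-- The symmetry of `tateRank` under `n ↦ -n - 1` makes `u` even, and the exponents obey the
recursion of `nu`. The natural number `d` also records that `nu (|n| - 1) s` is non-negative. -/
theorem exists_pow_nu_of_recursion {p s : ℕ} (hp : p.Prime) (hs : s ≠ 0) (u : ℤ → ℕ)
    (h0 : u 0 = 1) (hu : ∀ n, p ^ Rep.tateRank s n = u n * u (n + 1)) (n : ℤ) :
    ∃ d : ℕ, (d : ℤ) = nu (|n| - 1) s ∧ u n = p ^ d := by
  have key (j : ℕ) : ∃ d : ℕ, (d : ℤ) = nu (j - 1) s ∧ u j = p ^ d ∧ u (-j) = p ^ d := by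
    induction j with
    | zero => exact ⟨0, by simp [nu], by simpa using h0, by simpa using h0⟩
    | succ j ih =>
      obtain ⟨d, hd, h1, h2⟩ := ih
      have hj := hu j
      have hj' := hu (-j - 1)
      rw [Rep.tateRank_of_nonneg hs, h1] at hj
      rw [Rep.tateRank_of_neg hs, sub_add_cancel, h2] at hj'
      obtain ⟨d', -, hd'⟩ := (Nat.dvd_prime_pow hp).1 (Dvd.intro_left _ hj.symm)
      rw [hd', ← pow_add] at hj
      have hsum := Nat.pow_right_injective hp.two_le hj
      refine ⟨d', ?_, ?_, ?_⟩
      · rw [show ((j + 1 : ℕ) : ℤ) - 1 = j by push_cast; ring, nu_natCast, ← hd]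
        omega
      · rw [← hd', Nat.cast_succ]
      · rw [show (-((j + 1 : ℕ) : ℤ)) = -j - 1 by push_cast; ring]
        rw [hsum, add_comm d, pow_add] at hj'
        exact (Nat.eq_of_mul_eq_mul_right (pow_pos hp.pos d) hj').symm
  obtain ⟨d, hd, h1, h2⟩ := key n.natAbs
  rw [Int.natCast_natAbs] at hd h1 h2
  refine ⟨d, hd, ?_⟩
  rcases abs_choice n with h | h
  · rwa [h] at h1
  · rwa [h, neg_neg] at h2

/-! ### Endomorphisms that vanish on Tate cohomology -/

namespace Rep

variable {G : Type} [Group G] [Fintype G] {k : Type} [CommRing k] {X F : Rep.{0} k G}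

theorem nsmul_tateCohomology_eq_zero {p : ℕ} (hF : ∀ a : F, p • a = 0) (n : ℤ)
    (a : tateCohomology F n) : p • a = 0 := by
  conv_lhs => rw [← tateMap_id n a]
  rw [← tateMap_nsmul]
  have : p • 𝟙 F = 0 := by
    ext a
    exact hF a
  rw [this, tateMap_zero]

namespace IsShortExact

variable {φ : X ⟶ X} (hφ : ∀ n (a : tateCohomology X n), tateMap φ n a = 0)

include hφ

theorem tateMap_injective_of_tateMap_eq_zero {ψ : X ⟶ F} (h : IsShortExact φ ψ) (n : ℤ) :
    Function.Injective (tateMap ψ n) := by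
  rw [injective_iff_map_eq_zero]
  intro x hx
  obtain ⟨y, rfl⟩ := (h.exact₂ n x).1 hx
  exact hφ n y

/-- As `φ` induces zero, the long exact sequence splits into `0 → Ĥⁿ(X) → Ĥⁿ(F) → Ĥⁿ⁺¹(X) → 0`. -/
theorem card_eq_of_tateMap_eq_zero {ψ : X ⟶ F} (h : IsShortExact φ ψ) (n : ℤ) :
    Nat.card (tateCohomology F n) =
      Nat.card (tateCohomology X n) * Nat.card (tateCohomology X (n + 1)) :=
  AddMonoidHom.card_mul_of_exact (h.exact₃ n (n + 1) rfl)
    (h.tateMap_injective_of_tateMap_eq_zero hφ n) fun x => (h.exact₁ n (n + 1) rfl x).1 (hφ _ x)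

theorem δ_injective_of_tateMap_eq_zero {ι : F ⟶ X} (h : IsShortExact ι φ) (n m : ℤ)
    (hnm : n + 1 = m) : Function.Injective (h.δ n m hnm) := by
  rw [injective_iff_map_eq_zero]
  intro x hx
  obtain ⟨y, rfl⟩ := (h.exact₃ n m hnm x).1 hx
  exact hφ n y

theorem card_eq_of_tateMap_eq_zero' {ι : F ⟶ X} (h : IsShortExact ι φ) (n m : ℤ)
    (hnm : n + 1 = m) :
    Nat.card (tateCohomology F m) =
      Nat.card (tateCohomology X n) * Nat.card (tateCohomology X m) :=
  AddMonoidHom.card_mul_of_exact (h.exact₁ n m hnm) (h.δ_injective_of_tateMap_eq_zero hφ n m hnm)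
    fun x => (h.exact₂ m x).1 (hφ _ x)

end IsShortExact

end Rep

namespace Rep

variable {G : Type} [CommGroup G] [Fintype G] {k : Type} [CommRing k] (X : Rep.{0} k G)

/-- The endomorphism `g - 1` of a representation of a commutative group. -/
noncomputable def subOne (g : G) : X ⟶ X := X.applyAsHom g - 𝟙 X

omit [Fintype G] in
theorem subOne_hom_apply (g : G) (x : X) : (X.subOne g).hom x = X.ρ g x - x := rfl

theorem tateMap_subOne (g : G) (n : ℤ) (a : tateCohomology X n) :
    tateMap (X.subOne g) n a = 0 := by
  rw [subOne, tateMap_sub, tateMap_applyAsHom, tateMap_id, sub_self]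

variable {X}

/-- Already the invariants vanish; in degree `-1` below, already the coinvariants do. -/
theorem subsingleton_tateCohomology_zero {g : G} (hg : Function.Injective (X.subOne g).hom) :
    Subsingleton (tateCohomology X 0) := by
  refine CochainComplex.subsingleton_homology (K := tateComplex X) (-1) 0 1 rfl fun x hx => ?_
  change (Fin 0 → G) → X at x
  rw [tateComplex_d_zero_apply_eq_zero_iff] at hx
  refine ⟨0, (map_zero _).trans (funext (α := Fin 0 → G) (β := fun _ => X) fun γ => hg ?_)⟩
  rw [Subsingleton.elim γ default, subOne_hom_apply X g (x default), hx, sub_self]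
  exact map_zero _

theorem subsingleton_tateCohomology_neg_one {g : G} (hg : Function.Surjective (X.subOne g).hom) :
    Subsingleton (tateCohomology X (-1)) := by
  refine CochainComplex.subsingleton_homology (K := tateComplex X) (-2) (-1) 0 rfl fun x hx => ?_
  change (Fin 0 → G) →₀ X at x
  rw [exists_tateComplex_d_neg_two_eq_iff]
  obtain ⟨y, hy⟩ := hg (x default)
  rw [← hy, subOne_hom_apply]
  exact Representation.Coinvariants.sub_mem_ker _ _

end Rep

end

/-! ### Irreducible lattices -/

section

open Polynomial

variable {G M : Type} [CommGroup G] [AddCommGroup M] {ρ : Representation ℤ G M}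

theorem MonoidHom.exists_forall_eq_pow {R : Type*} [CommRing R] [IsDomain R] [Finite G]
    (f : G →* R) : ∃ g, ∀ h, ∃ i : ℕ, f h = f g ^ i := by
  have : Finite f.toHomUnits.range := Finite.of_surjective _ f.toHomUnits.rangeRestrict_surjective
  have : IsCyclic f.toHomUnits.range := isCyclic_subgroup_units _
  obtain ⟨⟨_, g, rfl⟩, hg⟩ := IsCyclic.exists_generator (α := f.toHomUnits.range)
  refine ⟨g, fun h => ?_⟩
  have h1 := hg ⟨_, h, rfl⟩
  rw [← mem_powers_iff_mem_zpowers] at h1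
  obtain ⟨i, hi⟩ := h1
  exact ⟨i, (congrArg (fun u => (u.1 : R)) hi).symm⟩

namespace IsIrreducibleGLattice

theorem isAddTorsionFree (hM : IsIrreducibleGLattice ρ) : IsAddTorsionFree M :=
  have := hM.free
  Module.isTorsionFree_int_iff_isAddTorsionFree.1 inferInstance

/-- Schur's lemma: the kernel of `a` is stable, and its quotient embeds in `M`, hence is torsion
free. -/
theorem injective_of_commute (hM : IsIrreducibleGLattice ρ) {a : Module.End ℤ M}
    (ha : ∀ g, Commute a (ρ g)) (h0 : a ≠ 0) : Function.Injective a := by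
  have := hM.isAddTorsionFree
  have h := hM.eq_bot_or_eq_top a.toAddMonoidHom.ker (fun g x hx => ?_) ⟨fun n hn x y hxy => ?_⟩
  · rcases h with h | h
    · exact (AddMonoidHom.ker_eq_bot_iff a.toAddMonoidHom).1 h
    · refine absurd (LinearMap.ext fun x => ?_) h0
      have : x ∈ a.toAddMonoidHom.ker := h ▸ AddSubgroup.mem_top x
      exact this
  · have hx' : a x = 0 := hx
    have : a (ρ g x) = ρ g (a x) := LinearMap.congr_fun (ha g).eq x
    rw [AddMonoidHom.mem_ker]
    exact this.trans (by rw [hx', map_zero])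
  · apply QuotientAddGroup.kerLift_injective a.toAddMonoidHom
    apply nsmul_right_injective (M := M) hn
    have := congrArg (QuotientAddGroup.kerLift a.toAddMonoidHom) hxy
    simpa only [map_nsmul] using this

/-- The saturation `S` of `N` is stable and nonzero with torsion-free quotient, so it is `M`; then
`M ⧸ N` is finitely generated and torsion, hence finite. -/
theorem index_ne_zero (hM : IsIrreducibleGLattice ρ) {N : AddSubgroup M}
    (hN : ∀ g, ∀ x ∈ N, ρ g x ∈ N) (h0 : N ≠ ⊥) : N.index ≠ 0 := by
  have := hM.finite
  have := hM.isAddTorsionFree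
  let S : AddSubgroup M :=
    { carrier := {x | ∃ n : ℕ, n ≠ 0 ∧ n • x ∈ N}
      zero_mem' := ⟨1, one_ne_zero, by simp⟩
      add_mem' := by
        rintro x y ⟨n, hn, hx⟩ ⟨n', hn', hy⟩
        refine ⟨n * n', mul_ne_zero hn hn', ?_⟩
        rw [smul_add]
        refine add_mem ?_ ?_
        · rw [mul_comm, mul_smul]
          exact nsmul_mem hx n'
        · rw [mul_smul]
          exact nsmul_mem hy n
      neg_mem' := by
        rintro x ⟨n, hn, hx⟩
        exact ⟨n, hn, by rw [smul_neg]; exact neg_mem hx⟩ }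
  have hS : S = ⊤ := by
    refine (hM.eq_bot_or_eq_top S ?_ ⟨?_⟩).resolve_left fun hS => h0 ?_
    · rintro g x ⟨n, hn, hx⟩
      exact ⟨n, hn, by rw [← map_nsmul]; exact hN g _ hx⟩
    · intro n hn x y hxy
      induction x using QuotientAddGroup.induction_on with
      | H x =>
      induction y using QuotientAddGroup.induction_on with
      | H y =>
      have hxy' : ((n • x : M) : M ⧸ S) = ((n • y : M) : M ⧸ S) := hxy
      rw [QuotientAddGroup.eq] at hxy' ⊢
      obtain ⟨n', hn', h⟩ := hxy'
      refine ⟨n' * n, mul_ne_zero hn' hn, ?_⟩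
      rw [mul_smul, smul_add, smul_neg]
      exact h
    · rw [eq_bot_iff, ← hS]
      exact fun x hx => ⟨1, one_ne_zero, by rwa [one_smul]⟩
  have hfg : AddGroup.FG M := Module.Finite.iff_addGroup_fg.1 inferInstance
  have : Finite (M ⧸ N) := AddCommGroup.finite_of_fg_isAddTorsion _ fun x => by
    induction x using QuotientAddGroup.induction_on with
    | H x =>
      obtain ⟨n, hn, hx⟩ : x ∈ S := hS ▸ AddSubgroup.mem_top x
      rw [isOfFinAddOrder_iff_nsmul_eq_zero]
      refine ⟨n, Nat.pos_of_ne_zero hn, ?_⟩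
      exact (QuotientAddGroup.eq_zero_iff (n • x)).2 hx
  exact AddSubgroup.index_ne_zero_of_finite

open scoped IsMulCommutative in
/-- A finite abelian group acts on an irreducible lattice through a cyclic quotient. -/
theorem exists_forall_eq_pow [Finite G] (hM : IsIrreducibleGLattice ρ) :
    ∃ g, ∀ h, ∃ i : ℕ, ρ h = ρ g ^ i := by
  have hcomm (g h : G) : Commute (ρ g) (ρ h) := by
    rw [Commute, SemiconjBy, ← map_mul, mul_comm, map_mul]
  let R := Algebra.adjoin ℤ (Set.range ρ)
  have : IsMulCommutative R := Algebra.isMulCommutative_adjoin ℤ <| by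
    rintro _ ⟨g, rfl⟩ _ ⟨h, rfl⟩
    exact hcomm g h
  have hmem (g : G) : ρ g ∈ R := Algebra.subset_adjoin ⟨g, rfl⟩
  have hR (a : R) (g : G) : Commute a.1 (ρ g) :=
    congrArg Subtype.val (mul_comm a ⟨ρ g, hmem g⟩)
  have := hM.nontrivial
  -- Elements of `R` commute with the action, so the nonzero ones are injective on `M`.
  have : NoZeroDivisors R := ⟨fun {a b} hab => by
    rw [or_iff_not_imp_left]
    intro ha
    have ha' : a.1 ≠ 0 := fun h => ha (Subtype.ext h)
    refine Subtype.ext (LinearMap.ext fun x => hM.injective_of_commute (hR a) ha' ?_)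
    have : a.1 (b.1 x) = 0 := LinearMap.congr_fun (congrArg Subtype.val hab) x
    exact this.trans (map_zero a.1).symm⟩
  have : IsDomain R := NoZeroDivisors.to_isDomain R
  let f : G →* R :=
    { toFun g := ⟨ρ g, hmem g⟩
      map_one' := Subtype.ext (map_one ρ)
      map_mul' g h := Subtype.ext (map_mul ρ g h) }
  obtain ⟨g, hg⟩ := f.exists_forall_eq_pow
  refine ⟨g, fun h => ?_⟩
  obtain ⟨i, hi⟩ := hg h
  exact ⟨i, congrArg Subtype.val hi⟩

/-- As `ρ g` generates the image, polynomials in it commute with `G`, so Schur's lemma makes the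
nonzero ones injective; any `v ≠ 0` spans a submodule of finite index. -/
theorem exists_sub_one [Finite G] {p K : ℕ} (hp : p.Prime) (hG : Nat.card G = p ^ K)
    (hM : IsIrreducibleGLattice ρ) (hρ : ¬ ρ.IsTrivial) :
    ∃ g, (∀ h, ∃ i : ℕ, ρ h = ρ g ^ i) ∧ Function.Injective (ρ g - 1 : Module.End ℤ M) ∧
      Nat.card (M ⧸ LinearMap.range (ρ g - 1 : Module.End ℤ M)) = p := by
  have := hM.free
  have := hM.nontrivial
  obtain ⟨g, hg⟩ := hM.exists_forall_eq_pow
  have hne : ρ g ≠ 1 := by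
    intro h1
    refine hρ ⟨fun h => ?_⟩
    obtain ⟨i, hi⟩ := hg h
    rw [hi, h1, one_pow]
    rfl
  obtain ⟨j, -, hj⟩ := (Nat.dvd_prime_pow hp).1 (hG ▸ (orderOf_map_dvd ρ g).trans
    (orderOf_dvd_natCard g))
  have hj0 : 0 < j := by
    rcases Nat.eq_zero_or_pos j with rfl | h
    · rw [pow_zero, orderOf_eq_one_iff] at hj
      exact absurd hj hne
    · exact h
  have hcomm (P : ℤ[X]) (h : G) : Commute (aeval (ρ g) P) (ρ h) := by
    obtain ⟨i, hi⟩ := hg h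
    rw [hi]
    refine Commute.pow_right ?_ i
    simpa only [aeval_X] using (Commute.all P X).map (aeval (ρ g))
  have hinj (P : ℤ[X]) (hP : aeval (ρ g) P ≠ 0) : Function.Injective (aeval (ρ g) P) :=
    hM.injective_of_commute (hcomm P) hP
  refine ⟨g, hg, ?_, ?_⟩
  · have h1 : aeval (ρ g) (X - 1 : ℤ[X]) = ρ g - 1 := by simp
    rw [← h1]
    refine hinj _ ?_
    rw [h1]
    exact sub_ne_zero.2 hne
  · obtain ⟨v, hv⟩ := exists_ne (0 : M)
    let N : AddSubgroup M :=
      ((LinearMap.applyₗ v : Module.End ℤ M →ₗ[ℤ] M).toAddMonoidHom.comp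
        (aeval (ρ g) : ℤ[X] →ₐ[ℤ] Module.End ℤ M).toLinearMap.toAddMonoidHom).range
    have hN (x : M) : x ∈ N ↔ ∃ P : ℤ[X], aeval (ρ g) P v = x := Iff.rfl
    refine Module.End.card_quotient_range_sub_one hp hj0 hj hinj v N hN
      (hM.index_ne_zero (fun h x hx => ?_) fun hbot => hv ?_)
    · obtain ⟨P, rfl⟩ := (hN x).1 hx
      obtain ⟨i, hi⟩ := hg h
      exact (hN _).2 ⟨X ^ i * P, by rw [map_mul, map_pow, aeval_X, hi]; rfl⟩
    · have : v ∈ N := (hN v).2 ⟨1, by simp⟩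
      rwa [hbot, AddSubgroup.mem_bot] at this

end IsIrreducibleGLattice

end

/-! ### The theorem -/

open Rep in
theorem corollary4p2 {p : ℕ} (hp : p.Prime) {s : ℕ} (m : Fin s → ℕ) (hm : ∀ k, 0 < m k)
    {G : Type} [CommGroup G] [Fintype G]
    (e : G ≃* ((k : Fin s) → Multiplicative (ZMod (p ^ m k))))
    {M : Type} [AddCommGroup M] (ρ : Representation ℤ G M)
    (hM : IsIrreducibleGLattice ρ) (hnontriv : ¬ ρ.IsTrivial) (n : ℤ) :
    Nonempty (tateCohomology (Rep.of ρ) n ≃+ tateCohomology (Rep.of (dualRep ρ)) (n - 1)) ∧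
    ∃ d : ℕ, (d : ℤ) = nu (|n| - 1) s ∧
      Nonempty (tateCohomology (Rep.of (dualRep ρ)) (n - 1) ≃+ (Fin d → ZMod p)) := by
  have hG : Nat.card G = p ^ ∑ i, m i := by
    rw [Nat.card_congr e.toEquiv, Nat.card_pi, ← Finset.prod_pow_eq_pow_sum]
    exact Finset.prod_congr rfl fun i _ => Nat.card_zmod _
  have hs : s ≠ 0 := by
    rintro rfl
    have : Subsingleton G := e.injective.subsingleton
    exact hnontriv ⟨fun g => by rw [Subsingleton.elim g 1, map_one]; rfl⟩
  obtain ⟨g, hg, hinj, hcard⟩ := hM.exists_sub_one hp hG hnontriv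
  -- Every `h - 1` factors through `g - 1`; hence `G` acts trivially on the cokernel of `g - 1` and
  -- on the dual kernel.
  have hpow (h : G) : ∃ T : Module.End ℤ M, ρ h - 1 = (ρ g - 1) * T := by
    obtain ⟨i, hi⟩ := hg h
    exact ⟨_, by rw [hi, ← mul_geom_sum]⟩
  -- the lattice
  let X : Rep ℤ G := Rep.of ρ
  have hX : IsShortExact (X.subOne g) (cokerπ (X.subOne g)) := isShortExact_cokerπ _ hinj
  have hcardF : Nat.card (cokerRep (X.subOne g)) = p := hcard
  have htrivF (h : G) (a : cokerRep (X.subOne g)) : (cokerRep (X.subOne g)).ρ h a = a := by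
    obtain ⟨x, rfl⟩ := hX.surjective a
    obtain ⟨T, hT⟩ := hpow h
    rw [← Rep.hom_comm_apply, ← sub_eq_zero, ← map_sub]
    exact (hX.exact _).2 ⟨T x, (LinearMap.congr_fun hT x).symm⟩
  have hpF (a : cokerRep (X.subOne g)) : p • a = 0 := by
    rw [← hcardF]
    exact card_nsmul_eq_zero'
  have hcard₁ (n : ℤ) : p ^ tateRank s n =
      Nat.card (tateCohomology X n) * Nat.card (tateCohomology X (n + 1)) := by
    rw [← hX.card_eq_of_tateMap_eq_zero (X.tateMap_subOne g),
      card_tateCohomology_trivial hp m hm e htrivF hcardF]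
  have hzero₁ : Nat.card (tateCohomology X 0) = 1 := by
    have := subsingleton_tateCohomology_zero (X := X) (g := g) hinj
    exact Nat.card_unique
  have hp₁ (n : ℤ) (x : tateCohomology X n) : p • x = 0 := by
    apply hX.tateMap_injective_of_tateMap_eq_zero (X.tateMap_subOne g) n
    rw [map_nsmul, nsmul_tateCohomology_eq_zero hpF, map_zero]
  -- its dual
  let Y : Rep ℤ G := Rep.of (dualRep ρ)
  -- The dual action inverts, so `g⁻¹ - 1` on `DM` is the transpose of `g - 1`.
  have hYapply (f : M →ₗ[ℤ] AddCircle (1 : ℚ)) :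
      (Y.subOne g⁻¹).hom f = f ∘ₗ (ρ g - 1 : Module.End ℤ M) := by
    refine LinearMap.ext fun x => ?_
    change f (ρ g⁻¹⁻¹ x) - f x = f (ρ g x - x)
    rw [inv_inv, map_sub]
  have hsurj : Function.Surjective (Y.subOne g⁻¹).hom := fun f => by
    obtain ⟨f', hf'⟩ := CharacterModule.dual_surjective_of_injective _ hinj f.toAddMonoidHom
    refine ⟨f'.toIntLinearMap, (hYapply _).trans (LinearMap.ext fun x => ?_)⟩
    exact DFunLike.congr_fun hf' x
  have hY : IsShortExact (kerι (Y.subOne g⁻¹)) (Y.subOne g⁻¹) := isShortExact_kerι _ hsurj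
  have hcardF' : Nat.card (kerRep (Y.subOne g⁻¹)) = p := by
    rw [← card_linearMap_addCircle_of_card_eq_prime hp hcard]
    refine Nat.card_congr
      { toFun f := (LinearMap.range (ρ g - 1 : Module.End ℤ M)).liftQ f.1 ?_
        invFun f := ⟨f ∘ₗ (LinearMap.range (ρ g - 1 : Module.End ℤ M)).mkQ, ?_⟩
        left_inv f := Subtype.ext (Submodule.liftQ_mkQ _ _ _)
        right_inv f := Submodule.linearMap_qext _ (Submodule.liftQ_mkQ _ _ _) }
    · obtain ⟨f, hf⟩ := f
      rw [LinearMap.range_le_ker_iff]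
      exact (hYapply f).symm.trans hf
    · refine (hYapply _).trans ?_
      rw [LinearMap.comp_assoc, LinearMap.range_mkQ_comp, LinearMap.comp_zero]
  have htrivF' (h : G) (a : kerRep (Y.subOne g⁻¹)) : (kerRep (Y.subOne g⁻¹)).ρ h a = a := by
    obtain ⟨f, hf⟩ := a
    change M →ₗ[ℤ] AddCircle (1 : ℚ) at f
    have hf' : f ∘ₗ (ρ g - 1 : Module.End ℤ M) = 0 := (hYapply f).symm.trans hf
    refine Subtype.ext (LinearMap.ext fun x => ?_)
    obtain ⟨T, hT⟩ := hpow h⁻¹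
    change f (ρ h⁻¹ x) = f x
    rw [← sub_eq_zero, ← map_sub]
    have h1 : ρ h⁻¹ x - x = (ρ g - 1 : Module.End ℤ M) (T x) := LinearMap.congr_fun hT x
    rw [h1]
    exact LinearMap.congr_fun hf' (T x)
  have hpF' (a : kerRep (Y.subOne g⁻¹)) : p • a = 0 := by
    rw [← hcardF']
    exact card_nsmul_eq_zero'
  -- Now the trivial module is a kernel, so `Ĥⁿ` of it involves degrees `n - 1` and `n` of the dual.
  -- This is the degree shift in the theorem.
  have hcard₂ (n : ℤ) : p ^ tateRank s n =
      Nat.card (tateCohomology Y (n - 1)) * Nat.card (tateCohomology Y (n + 1 - 1)) := by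
    rw [add_sub_cancel_right, ← hY.card_eq_of_tateMap_eq_zero' (Y.tateMap_subOne g⁻¹) (n - 1) n
      (by ring), card_tateCohomology_trivial hp m hm e htrivF' hcardF']
  have hzero₂ : Nat.card (tateCohomology Y (0 - 1)) = 1 := by
    have := subsingleton_tateCohomology_neg_one hsurj
    rw [zero_sub]
    exact Nat.card_unique
  have hp₂ (n : ℤ) (x : tateCohomology Y n) : p • x = 0 := by
    apply hY.δ_injective_of_tateMap_eq_zero (Y.tateMap_subOne g⁻¹) n (n + 1) rfl
    rw [map_nsmul, nsmul_tateCohomology_eq_zero hpF', map_zero]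
  -- comparison
  obtain ⟨d, hd, h₁⟩ := exists_pow_nu_of_recursion hp hs _ hzero₁ hcard₁ n
  obtain ⟨d', hd', h₂⟩ := exists_pow_nu_of_recursion hp hs
    (fun n => Nat.card (tateCohomology Y (n - 1))) hzero₂ hcard₂ n
  obtain rfl : d = d' := by exact_mod_cast hd.trans hd'.symm
  obtain ⟨E₁⟩ := nonempty_addEquiv_fin_zmod hp (hp₁ n) h₁
  obtain ⟨E₂⟩ := nonempty_addEquiv_fin_zmod hp (hp₂ (n - 1)) h₂
  exact ⟨⟨E₁.trans E₂.symm⟩, d, hd, ⟨E₂⟩⟩
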